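/- For a permutation $\pi\in S_n$ let $d(\pi)=\#\{1\le i\le n-1:\pi(i)>\pi(i+1)\}$ be its number of descents. For a partition $\lambda\vdash n$ let $\mathcal C_\lambda\subseteq S_n$ be the conjugacy class of permutations of cycle type $\lambda$, let $m_1$ be the number of parts of $\lambda$ equal to $1$ (the number of fixed points), and put $\alpha_\lambda=m_1/n$. Let $\pi$ be uniformly distributed on $\mathcal C_\lambda$, define the normalized descent number $W_\lambda$ by $$d(\pi)=\frac{n+1}{2}-\frac{m_1^2}{2n}+\sqrt n\,W_\lambda ,$$ and let $M_\lambda(s)=\mathbb E[e^{sW_\lambda}]$ be its moment generating function. Then there exists a function $C:\mathbb R\to(0,\infty)$ such that $$\left|M_\lambda(s)-\exp\left\{\frac{s^2}{24}\left(1-4\alpha_\lambda^3+3\alpha_\lambda^4\right)\right\}\right|\le C(s)\,\frac{(\log n)^3}{\sqrt n}$$ for every integer $n\ge 2$, every $\lambda\vdash n$ and every $s\in\mathbb R$. -/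

import Mathlib

namespace ConjDescents

/-- The descent set of a permutation `π` of `{0, …, n-1}`: the positions `i` that have a
successor `i + 1` and satisfy `π i > π (i + 1)`. -/
def descentSet {n : ℕ} (π : Equiv.Perm (Fin n)) : Finset (Fin n) :=
  {i : Fin n | ∃ h : (i : ℕ) + 1 < n, π ⟨(i : ℕ) + 1, h⟩ < π i}

/-- The descent number `d(π)`. -/
def descentNumber {n : ℕ} (π : Equiv.Perm (Fin n)) : ℕ := (descentSet π).card

/-- The conjugacy class `𝒞_lam` of the permutations in `S_n` whose cycle lengths (fixed points
counted as cycles of length one) are the parts of `lam`. -/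
def conjClass {n : ℕ} (lam : n.Partition) : Finset (Equiv.Perm (Fin n)) :=
  {π : Equiv.Perm (Fin n) | π.partition.parts = lam.parts}

/-- `m_i`, the number of parts of `lam` equal to `i`. -/
def mult {n : ℕ} (lam : n.Partition) (i : ℕ) : ℕ := lam.parts.count i

/-- All subsets of the finite set `S_n` are events. -/
instance permMeasurableSpace (n : ℕ) : MeasurableSpace (Equiv.Perm (Fin n)) := ⊤

/-- The law of a permutation drawn uniformly from `𝒞_lam`. -/
noncomputable def classLaw {n : ℕ} (lam : n.Partition) :
    MeasureTheory.Measure (Equiv.Perm (Fin n)) :=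
  ProbabilityTheory.uniformOn (conjClass lam : Set (Equiv.Perm (Fin n)))

/-- The normalized descent number `W_lam`, the solution of
`d(π) = (n + 1) / 2 - m₁ ^ 2 / (2 n) + √n * W_lam(π)`. -/
noncomputable def normalizedDescent {n : ℕ} (lam : n.Partition) (π : Equiv.Perm (Fin n)) : ℝ :=
  ((descentNumber π : ℝ) - (((n : ℝ) + 1) / 2 - (mult lam 1 : ℝ) ^ 2 / (2 * (n : ℝ))))
    / Real.sqrt (n : ℝ)

/-- The moment generating function `M_lam(s) = 𝔼[exp (s W_lam)]`. -/
noncomputable def descentMGF {n : ℕ} (lam : n.Partition) (s : ℝ) : ℝ :=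
  ProbabilityTheory.mgf (normalizedDescent lam) (classLaw lam) s

/-- `α_lam = m₁ / n`, the proportion of fixed points. -/
noncomputable def fixedRatio {n : ℕ} (lam : n.Partition) : ℝ := (mult lam 1 : ℝ) / (n : ℝ)

end ConjDescents

/-!
Fix `c` of cycle type `λ` and count the pairs of a total order on the `n` points and a weakly
monotone coloring with `k` colors for which `c` preserves (or, for the other orientation, reverses)
the order of equally colored points. Reading the points in increasing order turns the count into a
sum over the conjugates `π` of `c` of binomial coefficients `(k + n - 1 - d(π)).choose n`
(respectively `(k + d(π)).choose n`), so that the moment generating function of `d` at `∓τ` is the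
average, under negative binomial weights `exp (-τ k)` in `k`, of the proportion of compatible pairs.

The order of a compatible pair is essentially determined by the color sequences along the orbits of
`c`: only the fixed points have an appreciable number of ties. Hence the count is
`k ^ (n - m₁)` times the rising (respectively falling) factorial of `k` of length `m₁`, up to a
factor `1 + O(1 / k + n / k ^ 2) ^ n`. The upper bound adds one cycle at a time, and the lower bound
uses colorings of the moved points that separate any two of them within two steps of `c`.

With `k = n x / τ` and `τ = |s| / √n`, the logarithm of the proportion is
`-n τ p / x + n τ ^ 2 r / (2 x ^ 2) + O(τ)`, where `p = (1 ∓ α ^ 2) / 2` and `r = (1 - α ^ 3) / 3`.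
The weights concentrate at `x = 1`, and replacing this function by its tangent there keeps them
negative binomial. The average is then explicit, and its logarithm is
`s ^ 2 / 2 * (r + p ^ 2 - p) + O(τ) = s ^ 2 / 24 * (1 - 4 α ^ 3 + 3 α ^ 4) + O(τ)`.
-/

namespace ConjDescents

open Finset

/-! ### Compatible colored orders -/

/-- The relation `r` for `e = true` and its converse for `e = false`. The two orientations serve
the moment generating function at negative and at positive arguments. -/
def orient {V : Type*} (e : Bool) (r : V → V → Prop) (u v : V) : Prop :=
  if e then r u v else r v u

/-- A strict total order `r` on `A` together with a coloring `f` of `A` that is weakly monotone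
for `r`, such that the permutation `c` preserves (`e = true`) or reverses (`e = false`) the order
of any two points of the same color. Outside `A` the relation is empty and the color is `0`, so
that a pair is determined by its values on `A`. -/
structure IsCompatible {V : Type*} {k : ℕ} [NeZero k] (e : Bool) (c : Equiv.Perm V) (A : Finset V)
    (r : V → V → Prop) (f : V → Fin k) : Prop where
  mem_of_rel : ∀ {u v}, r u v → u ∈ A ∧ v ∈ A
  color_eq_zero : ∀ {v}, v ∉ A → f v = 0
  irrefl : ∀ u, ¬ r u u
  trans : ∀ {u v w}, r u v → r v w → r u w
  total : ∀ {u v}, u ∈ A → v ∈ A → u ≠ v → r u v ∨ r v u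
  rel_of_color_lt : ∀ {u v}, u ∈ A → v ∈ A → f u < f v → r u v
  rel_iff_orient : ∀ {u v}, u ∈ A → v ∈ A → f u = f v → (r u v ↔ orient e r (c u) (c v))

/-- `u` and `v` carry the same color sequence along their `c`-orbits. -/
def SameWord {V : Type*} {k : ℕ} (c : Equiv.Perm V) (f : V → Fin k) (u v : V) : Prop :=
  ∀ j : ℕ, f ((c ^ j) u) = f ((c ^ j) v)

section

variable {V : Type*} {k : ℕ} {e : Bool} {c : Equiv.Perm V} {A : Finset V}
  {r r' : V → V → Prop} {f : V → Fin k} {u v w : V}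

@[simp]
lemma orient_true : orient true r u v ↔ r u v := Iff.rfl

@[simp]
lemma orient_false : orient false r u v ↔ r v u := Iff.rfl

namespace SameWord

lemma color_eq (h : SameWord c f u v) : f u = f v := h 0

lemma symm (h : SameWord c f u v) : SameWord c f v u := fun j => (h j).symm

lemma trans (h : SameWord c f u v) (h' : SameWord c f v w) : SameWord c f u w :=
  fun j => (h j).trans (h' j)

lemma pow (h : SameWord c f u v) (i : ℕ) : SameWord c f ((c ^ i) u) ((c ^ i) v) := fun j => by
  simp only [← Equiv.Perm.mul_apply, ← pow_add, h (j + i)]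

lemma apply (h : SameWord c f u v) : SameWord c f (c u) (c v) := h.pow 1

end SameWord

lemma pow_apply_mem_iff (hA : ∀ v, c v ∈ A ↔ v ∈ A) (j : ℕ) (v : V) : (c ^ j) v ∈ A ↔ v ∈ A := by
  induction j with
  | zero => rfl
  | succ j ih => rw [pow_succ', Equiv.Perm.mul_apply, hA, ih]

lemma not_forall_rel_pow_succ [Finite V] [IsTrans V r] [Std.Irrefl r] (g : Equiv.Perm V) (u : V) :
    ¬ ∀ a : ℕ, r ((g ^ a) u) ((g ^ (a + 1)) u) := fun h => by
  have hreturn := Nat.rel_of_forall_rel_succ_of_lt r h (orderOf_pos g)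
  rw [pow_orderOf_eq_one, pow_zero] at hreturn
  exact irrefl_of r _ hreturn

namespace IsCompatible

variable [NeZero k]

lemma asymm (h : IsCompatible e c A r f) (huv : r u v) : ¬ r v u :=
  fun hvu => h.irrefl u (h.trans huv hvu)

lemma not_rel_iff (h : IsCompatible e c A r f) (hu : u ∈ A) (hv : v ∈ A) (huv : u ≠ v) :
    ¬ r u v ↔ r v u :=
  ⟨(h.total hu hv huv).resolve_left, h.asymm⟩

lemma rel_iff_color_lt (h : IsCompatible e c A r f) (hu : u ∈ A) (hv : v ∈ A) (huv : f u ≠ f v) :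
    r u v ↔ f u < f v :=
  ⟨fun hr => huv.lt_or_gt.resolve_right fun hlt => h.asymm hr (h.rel_of_color_lt hv hu hlt),
    h.rel_of_color_lt hu hv⟩

lemma restrict (h : IsCompatible e c A r f) {B : Finset V} [DecidablePred (· ∈ B)] (hBA : B ⊆ A)
    (hB : ∀ v, c v ∈ B ↔ v ∈ B) :
    IsCompatible e c B (fun u v => r u v ∧ u ∈ B ∧ v ∈ B) (fun v => if v ∈ B then f v else 0) where
  mem_of_rel h' := h'.2
  color_eq_zero h' := if_neg h'
  irrefl u h' := h.irrefl u h'.1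
  trans h₁ h₂ := ⟨h.trans h₁.1 h₂.1, h₁.2.1, h₂.2.2⟩
  total hu hv huv := by simpa [hu, hv] using h.total (hBA hu) (hBA hv) huv
  rel_of_color_lt hu hv hlt := by
    simp only [hu, hv, if_true] at hlt
    exact ⟨h.rel_of_color_lt (hBA hu) (hBA hv) hlt, hu, hv⟩
  rel_iff_orient {u v} hu hv heq := by
    simp only [hu, hv, if_true] at heq
    cases e <;> simpa [hu, hv, hB] using h.rel_iff_orient (hBA hu) (hBA hv) heq

lemma rel_iff_pow (h : IsCompatible e c A r f) (hA : ∀ v, c v ∈ A ↔ v ∈ A) {N : ℕ}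
    (hN : e = true ∨ Even N) (hu : u ∈ A) (hv : v ∈ A) (hs : SameWord c f u v) :
    r u v ↔ r ((c ^ N) u) ((c ^ N) v) := by
  cases e with
  | true =>
    clear hN
    induction N generalizing u v with
    | zero => rfl
    | succ N ih =>
      rw [h.rel_iff_orient hu hv hs.color_eq, orient_true,
        ih ((hA u).2 hu) ((hA v).2 hv) hs.apply, pow_succ, Equiv.Perm.mul_apply,
        Equiv.Perm.mul_apply]
  | false =>
    obtain ⟨i, rfl⟩ := hN.resolve_left Bool.false_ne_true
    clear hN
    induction i generalizing u v with
    | zero => rfl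
    | succ i ih =>
      have hu₁ := (hA u).2 hu
      have hv₁ := (hA v).2 hv
      rw [h.rel_iff_orient hu hv hs.color_eq, orient_false,
        h.rel_iff_orient hv₁ hu₁ hs.apply.symm.color_eq, orient_false,
        ih ((hA _).2 hu₁) ((hA _).2 hv₁) hs.apply.apply,
        show i + 1 + (i + 1) = i + i + 1 + 1 by ring]
      simp only [pow_succ, Equiv.Perm.mul_apply]

-- A power of `c` that moved `u` within its word class would move it monotonically, around a cycle.
lemma pow_apply_eq_self [Finite V] (h : IsCompatible e c A r f) (hA : ∀ v, c v ∈ A ↔ v ∈ A) {N : ℕ}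
    (hN : e = true ∨ Even N) (hu : u ∈ A) (hs : SameWord c f u ((c ^ N) u)) : (c ^ N) u = u := by
  by_contra hne
  have : IsTrans V r := ⟨fun _ _ _ => h.trans⟩
  have : IsTrans V (flip r) := ⟨fun _ _ _ h₁ h₂ => h.trans h₂ h₁⟩
  have : Std.Irrefl r := ⟨h.irrefl⟩
  have : Std.Irrefl (flip r) := ⟨h.irrefl⟩
  have hmem : (c ^ N) u ∈ A := (pow_apply_mem_iff hA N u).2 hu
  have hpar (a : ℕ) : e = true ∨ Even (N * a) := hN.imp id fun h => h.mul_right a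
  have hsucc (a : ℕ) : ((c ^ N) ^ a) ((c ^ N) u) = ((c ^ N) ^ (a + 1)) u := by
    rw [pow_succ, Equiv.Perm.mul_apply]
  rcases h.total hu hmem (Ne.symm hne) with hr | hr
  · refine not_forall_rel_pow_succ (r := r) (c ^ N) u fun a => ?_
    simpa only [pow_mul, hsucc] using (h.rel_iff_pow hA (hpar a) hu hmem hs).1 hr
  · refine not_forall_rel_pow_succ (r := flip r) (c ^ N) u fun a => ?_
    simpa only [flip, pow_mul, hsucc] using (h.rel_iff_pow hA (hpar a) hmem hu hs.symm).1 hr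

lemma pow_apply_eq_pow_apply [Finite V] (h : IsCompatible e c A r f)
    (hA : ∀ v, c v ∈ A ↔ v ∈ A) (hu : u ∈ A) {i j : ℕ} (hij : i ≤ j)
    (hpar : e = true ∨ Even (j - i)) (hs : SameWord c f ((c ^ i) u) ((c ^ j) u)) :
    (c ^ i) u = (c ^ j) u := by
  have hj : (c ^ j) u = (c ^ (j - i)) ((c ^ i) u) := by
    rw [← Equiv.Perm.mul_apply, ← pow_add, Nat.sub_add_cancel hij]
  rw [hj] at hs ⊢
  exact (h.pow_apply_eq_self hA hpar ((pow_apply_mem_iff hA i u).2 hu) hs).symm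

lemma eq_of_sameWord_of_sameCycle [Finite V] (h : IsCompatible e c A r f)
    (hA : ∀ v, c v ∈ A ↔ v ∈ A) {z : V} (hz : z ∈ A) (hu : c.SameCycle z u) (hv : c.SameCycle z v)
    (hsu : SameWord c f u z) (hsv : SameWord c f v z) (huz : u ≠ z) (hvz : v ≠ z) : u = v := by
  obtain ⟨i, rfl⟩ := hu.exists_nat_pow_eq
  obtain ⟨j, rfl⟩ := hv.exists_nat_pow_eq
  cases e with
  | true => exact absurd (h.pow_apply_eq_self hA (Or.inl rfl) hz hsu.symm) huz
  | false =>
    have odd_exponent {q : ℕ} (hs : SameWord c f ((c ^ q) z) z) (hne : (c ^ q) z ≠ z) : Odd q := by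
      by_contra hq
      exact hne (h.pow_apply_eq_self hA (Or.inr (Nat.not_odd_iff_even.1 hq)) hz hs.symm)
    have hi := odd_exponent hsu huz
    have hj := odd_exponent hsv hvz
    rcases le_total i j with hij | hji
    · exact h.pow_apply_eq_pow_apply hA hz hij (Or.inr (Nat.Odd.sub_odd hj hi)) (hsu.trans hsv.symm)
    · exact (h.pow_apply_eq_pow_apply hA hz hji (Or.inr (Nat.Odd.sub_odd hi hj))
        (hsv.trans hsu.symm)).symm

lemma agree_symm (h : IsCompatible e c A r f) (h' : IsCompatible e c A r' f)
    (hu : u ∈ A) (hv : v ∈ A) (ha : r u v ↔ r' u v) : r v u ↔ r' v u := by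
  rcases eq_or_ne u v with rfl | huv
  · exact ha
  · rw [← h.not_rel_iff hu hv huv, ← h'.not_rel_iff hu hv huv, ha]

lemma agree_of_color_ne (h : IsCompatible e c A r f) (h' : IsCompatible e c A r' f)
    (hu : u ∈ A) (hv : v ∈ A) (huv : f u ≠ f v) : r u v ↔ r' u v := by
  rw [h.rel_iff_color_lt hu hv huv, h'.rel_iff_color_lt hu hv huv]

lemma agree_of_agree_pow (h : IsCompatible e c A r f) (h' : IsCompatible e c A r' f)
    (hA : ∀ v, c v ∈ A ↔ v ∈ A) (j : ℕ) (hu : u ∈ A) (hv : v ∈ A)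
    (ha : r ((c ^ j) u) ((c ^ j) v) ↔ r' ((c ^ j) u) ((c ^ j) v)) : r u v ↔ r' u v := by
  induction j generalizing u v with
  | zero => exact ha
  | succ j ih =>
    by_cases heq : f u = f v
    · have hcu := (hA u).2 hu
      have hcv := (hA v).2 hv
      rw [pow_succ, Equiv.Perm.mul_apply, Equiv.Perm.mul_apply] at ha
      rw [h.rel_iff_orient hu hv heq, h'.rel_iff_orient hu hv heq]
      cases e with
      | true => exact ih hcu hcv ha
      | false => exact h.agree_symm h' hcu hcv (ih hcu hcv ha)
    · exact h.agree_of_color_ne h' hu hv heq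

lemma sameWord_of_disagree (h : IsCompatible e c A r f) (h' : IsCompatible e c A r' f)
    (hA : ∀ v, c v ∈ A ↔ v ∈ A) (hu : u ∈ A) (hv : v ∈ A)
    (ha : ¬ (r u v ↔ r' u v)) : SameWord c f u v := fun j => by
  by_contra hne
  refine ha (h.agree_of_agree_pow h' hA j hu hv (h.agree_of_color_ne h' ?_ ?_ hne))
  · exact (pow_apply_mem_iff hA j u).2 hu
  · exact (pow_apply_mem_iff hA j v).2 hv

lemma agree_of_pow_apply_eq (h : IsCompatible e c A r f) (h' : IsCompatible e c A r' f)
    (hA : ∀ v, c v ∈ A ↔ v ∈ A) {z : V}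
    (hz : ∀ v ∈ A, v ≠ z → SameWord c f v z → (r v z ↔ r' v z))
    (hu : u ∈ A) (hv : v ∈ A) {j : ℕ} (hj : (c ^ j) v = z) : r u v ↔ r' u v := by
  by_contra ha
  have hs := (h.sameWord_of_disagree h' hA hu hv ha).pow j
  refine ha (h.agree_of_agree_pow h' hA j hu hv ?_)
  rw [hj] at hs ⊢
  by_cases heq : (c ^ j) u = z
  · rw [heq]
    exact iff_of_false (h.irrefl z) (h'.irrefl z)
  · exact hz _ ((pow_apply_mem_iff hA j u).2 hu) heq hs

lemma rel_ext (h : IsCompatible e c A r f) (h' : IsCompatible e c A r' f)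
    (hA : ∀ v, c v ∈ A ↔ v ∈ A) {B : Finset V} {z : V}
    (hBz : ∀ v ∈ A, v ∉ B → ∃ j : ℕ, (c ^ j) v = z)
    (hB : ∀ u ∈ B, ∀ v ∈ B, (r u v ↔ r' u v))
    (hz : ∀ v ∈ A, v ≠ z → SameWord c f v z → (r v z ↔ r' v z)) : r = r' := by
  have agree_off_B {u v : V} (hu : u ∈ A) (hv : v ∈ A) (hvB : v ∉ B) : r u v ↔ r' u v := by
    obtain ⟨j, hj⟩ := hBz v hv hvB
    exact h.agree_of_pow_apply_eq h' hA hz hu hv hj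
  funext u v
  refine propext ?_
  by_cases huv : u ∈ A ∧ v ∈ A
  · obtain ⟨hu, hv⟩ := huv
    by_cases hvB : v ∈ B
    · by_cases huB : u ∈ B
      · exact hB u huB v hvB
      · exact h.agree_symm h' hv hu (agree_off_B hv hu huB)
    · exact agree_off_B hu hv hvB
  · exact iff_of_false (fun hr => huv (h.mem_of_rel hr)) (fun hr => huv (h'.mem_of_rel hr))

lemma exists_greatest [Finite V] (h : IsCompatible e c A r f) {S : Set V} (hS : S.Nonempty)
    (hSA : ∀ v ∈ S, v ∈ A) : ∃ m ∈ S, ∀ v ∈ S, v = m ∨ r v m := by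
  have : IsTrans V (flip r) := ⟨fun _ _ _ h₁ h₂ => h.trans h₂ h₁⟩
  have : Std.Irrefl (flip r) := ⟨h.irrefl⟩
  obtain ⟨m, hm, hmax⟩ := (Finite.wellFounded_of_trans_of_irrefl (flip r)).has_min S hS
  exact ⟨m, hm, fun v hv => or_iff_not_imp_left.2 fun hvm =>
    (h.total (hSA v hv) (hSA m hm) hvm).resolve_right (hmax v hv)⟩

end IsCompatible

end

/-! ### Upper bound: adding one cycle at a time -/

/-- A binary relation on `V` together with a coloring of `V` in `k` colors. -/
abbrev ColoredOrder (V : Type*) (k : ℕ) : Type _ := (V → V → Prop) × (V → Fin k)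

open Classical in
/-- All compatible pairs on `A` with `k` colors. -/
noncomputable def compatiblePairs {V : Type*} [Fintype V] (e : Bool) (c : Equiv.Perm V)
    (k : ℕ) [NeZero k] (A : Finset V) : Finset (ColoredOrder V k) :=
  {p | IsCompatible e c A p.1 p.2}

/-- The points of the cycle of `c` through `z`; unlike `(c.cycleOf z).support` it contains `z` also
when `z` is a fixed point. -/
def cycleThrough {V : Type*} [Fintype V] [DecidableEq V] (c : Equiv.Perm V) (z : V) : Finset V :=
  {v | c.SameCycle z v}

/-- Some other point of the cycle of `z` has the word of `z` and lies below `z`. -/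
def HasTwinBelow {V : Type*} {k : ℕ} (c : Equiv.Perm V) (z : V) (p : ColoredOrder V k) : Prop :=
  ∃ v, c.SameCycle z v ∧ v ≠ z ∧ SameWord c p.2 v z ∧ p.1 v z

/-- `v` is the largest point of `A` below `z` that has the word of `z`. -/
structure IsTopPeerBelow {V : Type*} {k : ℕ} (c : Equiv.Perm V) (A : Finset V) (z : V)
    (p : ColoredOrder V k) (v : V) : Prop where
  mem : v ∈ A
  sameWord : SameWord c p.2 v z
  rel : p.1 v z
  eq_or_rel : ∀ w ∈ A, SameWord c p.2 w z → p.1 w z → w = v ∨ p.1 w v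

/-- No point of `A` below `z` has the word of `z`. -/
def NoPeerBelow {V : Type*} {k : ℕ} (c : Equiv.Perm V) (A : Finset V) (z : V)
    (p : ColoredOrder V k) : Prop :=
  ∀ w ∈ A, SameWord c p.2 w z → ¬ p.1 w z

/-- The restriction of a relation and a coloring to `A`, extended by the empty relation and the
color `0`. -/
def restrictPair {V : Type*} [DecidableEq V] {k : ℕ} [NeZero k] (A : Finset V)
    (p : ColoredOrder V k) : ColoredOrder V k :=
  (fun u v => p.1 u v ∧ u ∈ A ∧ v ∈ A, fun v => if v ∈ A then p.2 v else 0)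

/-- The number of compatible pairs on `m` fixed points: the rising (`e = true`) or falling
(`e = false`) factorial. -/
def orientedFactorial (e : Bool) (k m : ℕ) : ℕ :=
  if e then k.ascFactorial m else k.descFactorial m

/-- The fixed points of `c`. -/
def fixedSet {V : Type*} [Fintype V] [DecidableEq V] (c : Equiv.Perm V) : Finset V :=
  {v | c v = v}

section

variable {V : Type*} {k : ℕ} {e : Bool} {c : Equiv.Perm V} {A Z : Finset V} {z v : V}
  {p q : ColoredOrder V k}

lemma mem_compatiblePairs [Fintype V] [NeZero k] :
    p ∈ compatiblePairs e c k A ↔ IsCompatible e c A p.1 p.2 := by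
  simp [compatiblePairs]

lemma not_hasTwinBelow_of_apply_eq_self (hz : c z = z) (p : ColoredOrder V k) :
    ¬ HasTwinBelow c z p :=
  fun ⟨_, hcyc, hvz, _⟩ => hvz (hcyc.eq_of_left hz).symm

lemma noPeerBelow_or_exists_isTopPeerBelow [Finite V] [NeZero k]
    (hp : IsCompatible e c Z p.1 p.2) (hAZ : A ⊆ Z) :
    NoPeerBelow c A z p ∨ ∃ v, IsTopPeerBelow c A z p v := by
  refine or_iff_not_imp_left.2 fun h => ?_
  simp only [NoPeerBelow, not_forall, not_not] at h
  obtain ⟨w, hwA, hws, hwz⟩ := h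
  obtain ⟨m, ⟨hmA, hms, hmz⟩, hmax⟩ :=
    hp.exists_greatest (S := {w | w ∈ A ∧ SameWord c p.2 w z ∧ p.1 w z}) ⟨w, hwA, hws, hwz⟩
      fun _ hv => hAZ hv.1
  exact ⟨m, hmA, hms, hmz, fun w h₁ h₂ h₃ => hmax w ⟨h₁, h₂, h₃⟩⟩

lemma hasTwinBelow_iff_rel [Finite V] [NeZero k] {r : V → V → Prop} {f : V → Fin k}
    (hp : IsCompatible e c A r f) (hA : ∀ v, c v ∈ A ↔ v ∈ A) (hz : z ∈ A)
    (hv : c.SameCycle z v) (hvz : v ≠ z) (hs : SameWord c f v z) (r' : V → V → Prop) :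
    HasTwinBelow c z (r', f) ↔ r' v z := by
  refine ⟨fun ⟨w, hw, hwz, hws, hr⟩ => ?_, fun hr => ⟨v, hv, hvz, hs, hr⟩⟩
  rwa [hp.eq_of_sameWord_of_sameCycle hA hz hw hv hws hs hwz hvz] at hr

lemma card_compatiblePairs_empty_le_one [Fintype V] [NeZero k] :
    #(compatiblePairs e c k ∅) ≤ 1 := by
  refine card_le_one.2 fun p hp q hq => ?_
  rw [mem_compatiblePairs] at hp hq
  refine Prod.ext (funext₂ fun u v => propext (iff_of_false ?_ ?_)) (funext fun v => ?_)
  · exact fun h => notMem_empty u (hp.mem_of_rel h).1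
  · exact fun h => notMem_empty u (hq.mem_of_rel h).1
  · rw [hp.color_eq_zero (notMem_empty v), hq.color_eq_zero (notMem_empty v)]

lemma color_injOn_of_fixed [NeZero k] (hp : IsCompatible false c A p.1 p.2)
    (hfix : ∀ v ∈ A, c v = v) : Set.InjOn p.2 A := fun u hu v hv huv => by
  by_contra hne
  have hswap := hp.rel_iff_orient hu hv huv
  rw [hfix u hu, hfix v hv, orient_false] at hswap
  rcases hp.total hu hv hne with h | h
  · exact hp.asymm h (hswap.1 h)
  · exact hp.asymm h (hswap.2 h)

variable [DecidableEq V]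

section restrictPair

variable [NeZero k]

lemma rel_iff_of_restrictPair_eq (hpq : restrictPair A p = restrictPair A q) {u v : V} (hu : u ∈ A)
    (hv : v ∈ A) : p.1 u v ↔ q.1 u v := by
  simpa [restrictPair, hu, hv] using congrFun₂ (congrArg Prod.fst hpq) u v

lemma color_eq_of_restrictPair_eq (hpq : restrictPair A p = restrictPair A q) (hv : v ∈ A) :
    p.2 v = q.2 v := by
  simpa [restrictPair, hv] using congrFun (congrArg Prod.snd hpq) v

lemma coloring_eq_of_restrictPair_eq (hp : IsCompatible e c (A ∪ Z) p.1 p.2)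
    (hq : IsCompatible e c (A ∪ Z) q.1 q.2) (hpq : restrictPair A p = restrictPair A q)
    (hZ : ∀ v ∈ Z, p.2 v = q.2 v) : p.2 = q.2 := by
  funext v
  by_cases hvA : v ∈ A
  · exact color_eq_of_restrictPair_eq hpq hvA
  by_cases hvZ : v ∈ Z
  · exact hZ v hvZ
  · rw [hp.color_eq_zero (by simp [hvA, hvZ]), hq.color_eq_zero (by simp [hvA, hvZ])]

lemma restrictPair_mem [Fintype V] (hA : ∀ v, c v ∈ A ↔ v ∈ A)
    (hp : p ∈ compatiblePairs e c k (A ∪ Z)) : restrictPair A p ∈ compatiblePairs e c k A :=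
  mem_compatiblePairs.2 ((mem_compatiblePairs.1 hp).restrict subset_union_left hA)

lemma card_compatiblePairs_union_le_mul [Fintype V] (hA : ∀ v, c v ∈ A ↔ v ∈ A) (N : ℕ)
    (hfiber : ∀ s ⊆ compatiblePairs e c k (A ∪ Z),
      (∀ p ∈ s, ∀ q ∈ s, restrictPair A p = restrictPair A q) → #s ≤ N) :
    #(compatiblePairs e c k (A ∪ Z)) ≤ N * #(compatiblePairs e c k A) := by
  classical
  refine card_le_mul_card_image_of_maps_to (f := restrictPair A)
    (fun p hp => restrictPair_mem hA hp) N fun b _ => hfiber _ (filter_subset _ _) ?_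
  intro p hp q hq
  rw [(mem_filter.1 hp).2, (mem_filter.1 hq).2]

end restrictPair

variable [Fintype V]

@[simp]
lemma mem_cycleThrough : v ∈ cycleThrough c z ↔ c.SameCycle z v := by simp [cycleThrough]

lemma self_mem_cycleThrough (c : Equiv.Perm V) (z : V) : z ∈ cycleThrough c z :=
  mem_cycleThrough.2 (.refl c z)

lemma apply_mem_cycleThrough_iff (c : Equiv.Perm V) (z v : V) :
    c v ∈ cycleThrough c z ↔ v ∈ cycleThrough c z := by simp

lemma cycleThrough_eq_singleton (hz : c z = z) : cycleThrough c z = {z} := by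
  ext v
  rw [mem_cycleThrough, mem_singleton]
  exact ⟨fun h => (h.eq_of_left hz).symm, fun h => h ▸ .refl c z⟩

lemma apply_mem_union_cycleThrough_iff (hA : ∀ v, c v ∈ A ↔ v ∈ A) (v : V) :
    c v ∈ A ∪ cycleThrough c z ↔ v ∈ A ∪ cycleThrough c z := by
  simp [hA]

lemma cycleThrough_subset (hA : ∀ v, c v ∈ A ↔ v ∈ A) (hz : z ∈ A) : cycleThrough c z ⊆ A :=
  fun v hv => by
    obtain ⟨j, rfl⟩ := (mem_cycleThrough.1 hv).exists_nat_pow_eq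
    exact (pow_apply_mem_iff hA j z).2 hz

section fiber

variable [NeZero k]

lemma pair_eq_of_agree (hA : ∀ v, c v ∈ A ↔ v ∈ A)
    (hp : IsCompatible e c (A ∪ cycleThrough c z) p.1 p.2)
    (hq : IsCompatible e c (A ∪ cycleThrough c z) q.1 q.2)
    (hpq : restrictPair A p = restrictPair A q) (hZ : ∀ v ∈ cycleThrough c z, p.2 v = q.2 v)
    (htwin : HasTwinBelow c z p ↔ HasTwinBelow c z q)
    (hAz : ∀ v ∈ A, SameWord c p.2 v z → (p.1 v z ↔ q.1 v z)) : p = q := by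
  have hinv := apply_mem_union_cycleThrough_iff (z := z) hA
  have hzmem : z ∈ A ∪ cycleThrough c z := mem_union_right _ (self_mem_cycleThrough c z)
  obtain ⟨r, f⟩ := p
  obtain ⟨r', f'⟩ := q
  obtain rfl : f = f' := coloring_eq_of_restrictPair_eq hp hq hpq hZ
  refine Prod.ext (hp.rel_ext hq hinv (B := A) (z := z) (fun v hv hvA => ?_)
    (fun u hu v hv => rel_iff_of_restrictPair_eq hpq hu hv) fun v hv hvz hs => ?_) rfl
  · exact (mem_cycleThrough.1 ((mem_union.1 hv).resolve_left hvA)).symm.exists_nat_pow_eq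
  · rcases mem_union.1 hv with hvA | hvZ
    · exact hAz v hvA hs
    · have hcyc := mem_cycleThrough.1 hvZ
      rwa [hasTwinBelow_iff_rel hp hinv hzmem hcyc hvz hs,
        hasTwinBelow_iff_rel hp hinv hzmem hcyc hvz hs] at htwin

lemma pair_eq_of_isTopPeerBelow (hA : ∀ v, c v ∈ A ↔ v ∈ A)
    (hp : IsCompatible e c (A ∪ cycleThrough c z) p.1 p.2)
    (hq : IsCompatible e c (A ∪ cycleThrough c z) q.1 q.2)
    (hpq : restrictPair A p = restrictPair A q)
    (htwin : HasTwinBelow c z p ↔ HasTwinBelow c z q)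
    (hpv : IsTopPeerBelow c A z p v) (hqv : IsTopPeerBelow c A z q v) : p = q := by
  have hZ : ∀ w ∈ cycleThrough c z, p.2 w = q.2 w := fun w hw => by
    obtain ⟨j, rfl⟩ := (mem_cycleThrough.1 hw).exists_nat_pow_eq
    rw [← hpv.sameWord j, ← hqv.sameWord j]
    exact color_eq_of_restrictPair_eq hpq ((pow_apply_mem_iff hA j v).2 hpv.mem)
  have hcol := coloring_eq_of_restrictPair_eq hp hq hpq hZ
  refine pair_eq_of_agree hA hp hq hpq hZ htwin fun w hw hs => ?_
  have hpw : p.1 w z ↔ w = v ∨ p.1 w v :=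
    ⟨hpv.eq_or_rel w hw hs, Or.rec (fun h => h ▸ hpv.rel) fun h => hp.trans h hpv.rel⟩
  have hqw : q.1 w z ↔ w = v ∨ q.1 w v :=
    ⟨hqv.eq_or_rel w hw (hcol ▸ hs), Or.rec (fun h => h ▸ hqv.rel) fun h => hq.trans h hqv.rel⟩
  rw [hpw, hqw, rel_iff_of_restrictPair_eq hpq hw hpv.mem]

lemma pair_eq_of_noPeerBelow (hA : ∀ v, c v ∈ A ↔ v ∈ A)
    (hp : IsCompatible e c (A ∪ cycleThrough c z) p.1 p.2)
    (hq : IsCompatible e c (A ∪ cycleThrough c z) q.1 q.2)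
    (hpq : restrictPair A p = restrictPair A q)
    (htwin : HasTwinBelow c z p ↔ HasTwinBelow c z q)
    (hZ : ∀ v ∈ cycleThrough c z, p.2 v = q.2 v)
    (hpz : NoPeerBelow c A z p) (hqz : NoPeerBelow c A z q) : p = q := by
  have hcol := coloring_eq_of_restrictPair_eq hp hq hpq hZ
  exact pair_eq_of_agree hA hp hq hpq hZ htwin fun w hw hs =>
    iff_of_false (hpz w hw hs) (hqz w hw (hcol ▸ hs))

variable {s : Finset (ColoredOrder V k)}

-- A pair of the fiber is coded by its top peer in `A`, or by the colors on the new cycle.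
lemma card_fiber_le_of_not_hasTwinBelow (hA : ∀ v, c v ∈ A ↔ v ∈ A)
    (hs : ∀ p ∈ s, IsCompatible e c (A ∪ cycleThrough c z) p.1 p.2)
    (hfiber : ∀ p ∈ s, ∀ q ∈ s, restrictPair A p = restrictPair A q)
    (htwin : ∀ p ∈ s, ¬ HasTwinBelow c z p) : #s ≤ k ^ #(cycleThrough c z) + #A := by
  let codes (p : ColoredOrder V k) : (cycleThrough c z → Fin k) ⊕ A → Prop := Sum.elim
    (fun g => NoPeerBelow c A z p ∧ ∀ v : cycleThrough c z, p.2 v = g v)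
    (fun v => IsTopPeerBelow c A z p v)
  have hcard := card_le_card_of_forall_subsingleton codes (s := s) (t := univ)
    (fun p hp => ?_) (fun x _ p ⟨hp, hpx⟩ q ⟨hq, hqx⟩ => ?_)
  · simpa only [card_univ, Fintype.card_sum, Fintype.card_fun, Fintype.card_coe,
      Fintype.card_fin] using hcard
  · rcases noPeerBelow_or_exists_isTopPeerBelow (z := z) (hs p hp) subset_union_left with h | ⟨v, h⟩
    · exact ⟨.inl fun v => p.2 v, mem_univ _, h, fun _ => rfl⟩
    · exact ⟨.inr ⟨v, h.mem⟩, mem_univ _, h⟩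
  · have htw := iff_of_false (htwin p hp) (htwin q hq)
    rcases x with g | v
    · exact pair_eq_of_noPeerBelow hA (hs p hp) (hs q hq) (hfiber p hp q hq) htw
        (fun v hv => (hpx.2 ⟨v, hv⟩).trans (hqx.2 ⟨v, hv⟩).symm) hpx.1 hqx.1
    · exact pair_eq_of_isTopPeerBelow hA (hs p hp) (hs q hq) (hfiber p hp q hq) htw hpx hqx

-- The twin of `z` has the color of `z`, which saves one color in the code of the pair.
lemma card_fiber_le_of_hasTwinBelow (hA : ∀ v, c v ∈ A ↔ v ∈ A)
    (hs : ∀ p ∈ s, IsCompatible e c (A ∪ cycleThrough c z) p.1 p.2)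
    (hfiber : ∀ p ∈ s, ∀ q ∈ s, restrictPair A p = restrictPair A q)
    (htwin : ∀ p ∈ s, HasTwinBelow c z p) :
    #s ≤ #(cycleThrough c z) * k ^ (#(cycleThrough c z) - 1) + #A := by
  let codes (p : ColoredOrder V k) :
      (cycleThrough c z × ((cycleThrough c z).erase z → Fin k)) ⊕ A → Prop := Sum.elim
    (fun g => NoPeerBelow c A z p ∧ (g.1 : V) ≠ z ∧ p.2 g.1 = p.2 z ∧
      ∀ v : (cycleThrough c z).erase z, p.2 v = g.2 v)
    (fun v => IsTopPeerBelow c A z p v)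
  have hcard := card_le_card_of_forall_subsingleton codes (s := s) (t := univ)
    (fun p hp => ?_) (fun x _ p ⟨hp, hpx⟩ q ⟨hq, hqx⟩ => ?_)
  · simpa only [card_univ, Fintype.card_sum, Fintype.card_prod, Fintype.card_fun, Fintype.card_coe,
      Fintype.card_fin, card_erase_of_mem (self_mem_cycleThrough c z)] using hcard
  · rcases noPeerBelow_or_exists_isTopPeerBelow (z := z) (hs p hp) subset_union_left with h | ⟨v, h⟩
    · obtain ⟨w, hw, hwz, hws, -⟩ := htwin p hp
      exact ⟨.inl (⟨w, mem_cycleThrough.2 hw⟩, fun v => p.2 v), mem_univ _, h, hwz, hws.color_eq,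
        fun _ => rfl⟩
    · exact ⟨.inr ⟨v, h.mem⟩, mem_univ _, h⟩
  · have htw := iff_of_true (htwin p hp) (htwin q hq)
    rcases x with ⟨w, g⟩ | v
    · obtain ⟨hpz, hwz, hpw, hpg⟩ := hpx
      obtain ⟨hqz, -, hqw, hqg⟩ := hqx
      have color_eq_off_z (v : V) (hv : v ∈ cycleThrough c z) (hvz : v ≠ z) : p.2 v = q.2 v :=
        (hpg ⟨v, mem_erase.2 ⟨hvz, hv⟩⟩).trans (hqg ⟨v, mem_erase.2 ⟨hvz, hv⟩⟩).symm
      refine pair_eq_of_noPeerBelow hA (hs p hp) (hs q hq) (hfiber p hp q hq) htw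
        (fun v hv => ?_) hpz hqz
      rcases eq_or_ne v z with rfl | hvz
      · rw [← hpw, ← hqw]
        exact color_eq_off_z w w.2 hwz
      · exact color_eq_off_z v hv hvz
    · exact pair_eq_of_isTopPeerBelow hA (hs p hp) (hs q hq) (hfiber p hp q hq) htw hpx hqx

lemma card_compatiblePairs_union_cycleThrough_le (hA : ∀ v, c v ∈ A ↔ v ∈ A) :
    #(compatiblePairs e c k (A ∪ cycleThrough c z)) ≤
      (k ^ #(cycleThrough c z) + #A +
        (#(cycleThrough c z) * k ^ (#(cycleThrough c z) - 1) + #A)) *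
        #(compatiblePairs e c k A) := by
  classical
  refine card_compatiblePairs_union_le_mul hA _ fun s hs hfiber => ?_
  have hcompat (P : ColoredOrder V k → Prop) [DecidablePred P] (p) (hp : p ∈ s.filter P) :
      IsCompatible e c (A ∪ cycleThrough c z) p.1 p.2 :=
    mem_compatiblePairs.1 (hs (mem_filter.1 hp).1)
  have hfiber' (P : ColoredOrder V k → Prop) [DecidablePred P] (p) (hp : p ∈ s.filter P)
      (q) (hq : q ∈ s.filter P) : restrictPair A p = restrictPair A q :=
    hfiber p (mem_filter.1 hp).1 q (mem_filter.1 hq).1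
  rw [← card_filter_add_card_filter_not (s := s) (HasTwinBelow c z), add_comm]
  exact Nat.add_le_add
    (card_fiber_le_of_not_hasTwinBelow hA (hcompat _) (hfiber' _) fun p hp => (mem_filter.1 hp).2)
    (card_fiber_le_of_hasTwinBelow hA (hcompat _) (hfiber' _) fun p hp => (mem_filter.1 hp).2)

lemma card_compatiblePairs_insert_fixed_le (hA : ∀ v, c v ∈ A ↔ v ∈ A) (hz : c z = z) :
    #(compatiblePairs e c k (A ∪ {z})) ≤ (k + #A) * #(compatiblePairs e c k A) := by
  refine card_compatiblePairs_union_le_mul hA _ fun s hs hfiber => ?_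
  rw [← cycleThrough_eq_singleton hz] at hs
  simpa only [cycleThrough_eq_singleton hz, card_singleton, pow_one] using
    card_fiber_le_of_not_hasTwinBelow hA (fun p hp => mem_compatiblePairs.1 (hs hp)) hfiber
      fun p _ => not_hasTwinBelow_of_apply_eq_self hz p

lemma card_compatiblePairs_false_insert_fixed_le (hfix : ∀ v ∈ A ∪ {z}, c v = v)
    (hA : ∀ v, c v ∈ A ↔ v ∈ A) (hzA : z ∉ A) :
    #(compatiblePairs false c k (A ∪ {z})) ≤ (k - #A) * #(compatiblePairs false c k A) := by
  have hz : c z = z := hfix z (by simp)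
  refine card_compatiblePairs_union_le_mul hA _ fun s hs hfiber => ?_
  rcases s.eq_empty_or_nonempty with rfl | ⟨p₀, hp₀⟩
  · simp
  have hinj {p} (hp : p ∈ s) : Set.InjOn p.2 (A ∪ {z} : Finset V) :=
    color_injOn_of_fixed (mem_compatiblePairs.1 (hs hp)) hfix
  have color_ne {p} (hp : p ∈ s) {v : V} (hv : v ∈ A) : p.2 v ≠ p.2 z := fun h =>
    hzA (hinj hp (by simp [hv]) (by simp) h ▸ hv)
  have hcard : #((A.image p₀.2)ᶜ) = k - #A := by
    rw [card_compl, Fintype.card_fin, card_image_of_injOn ((hinj hp₀).mono (by simp))]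
  rw [← cycleThrough_eq_singleton hz] at hs
  rw [← hcard]
  refine card_le_card_of_injOn (fun p => p.2 z) (fun p hp => ?_) (fun p hp q hq hpq => ?_)
  · simp only [coe_compl, Set.mem_compl_iff, mem_coe, mem_image, not_exists, not_and]
    intro v hv
    rw [color_eq_of_restrictPair_eq (hfiber p₀ hp₀ p hp) hv]
    exact color_ne hp hv
  · have noPeer {p} (hp : p ∈ s) : NoPeerBelow c A z p :=
      fun w hw hws => absurd hws.color_eq (color_ne hp hw)
    refine pair_eq_of_noPeerBelow hA (mem_compatiblePairs.1 (hs hp))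
      (mem_compatiblePairs.1 (hs hq)) (hfiber p hp q hq)
      (iff_of_false (not_hasTwinBelow_of_apply_eq_self hz p)
        (not_hasTwinBelow_of_apply_eq_self hz q))
      (fun v hv => ?_) (noPeer hp) (noPeer hq)
    rw [cycleThrough_eq_singleton hz, mem_singleton] at hv
    exact hv ▸ hpq

end fiber

end

section

variable {V : Type*} [Fintype V] {k : ℕ} [NeZero k] {e : Bool} {c : Equiv.Perm V} {A : Finset V}
  {v : V}

lemma card_compatiblePairs_le_orientedFactorial (hfix : ∀ v ∈ A, c v = v) :
    #(compatiblePairs e c k A) ≤ orientedFactorial e k #A := by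
  classical
  induction A using Finset.induction_on with
  | empty => cases e <;> simpa [orientedFactorial] using card_compatiblePairs_empty_le_one
  | insert z A hz ih =>
    have hfixA : ∀ v ∈ A, c v = v := fun v hv => hfix v (mem_insert_of_mem hv)
    have hA (v : V) : c v ∈ A ↔ v ∈ A :=
      ⟨fun h => by rwa [c.injective (hfixA (c v) h)] at h, fun h => by rwa [hfixA v h]⟩
    have ih := ih hfixA
    rw [card_insert_of_notMem hz]
    rw [insert_eq, union_comm] at hfix ⊢
    cases e with
    | true =>
      rw [orientedFactorial, if_pos rfl] at ih ⊢
      rw [Nat.ascFactorial_succ]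
      exact (card_compatiblePairs_insert_fixed_le hA (hfix z (by simp))).trans
        (Nat.mul_le_mul_left _ ih)
    | false =>
      rw [orientedFactorial, if_neg Bool.false_ne_true] at ih ⊢
      rw [Nat.descFactorial_succ]
      exact (card_compatiblePairs_false_insert_fixed_le hfix hA hz).trans
        (Nat.mul_le_mul_left _ ih)

lemma cycle_factor_le {i a n k : ℕ} (hk : 0 < k) (hi : 2 ≤ i) (ha : a ≤ n) :
    ((k ^ i + a + (i * k ^ (i - 1) + a) : ℕ) : ℝ) ≤
      ((k : ℝ) * Real.exp (1 / k + 2 * n / k ^ 2)) ^ i := by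
  have hk1 : (1 : ℝ) ≤ k := by exact_mod_cast hk
  have han : (a : ℝ) ≤ n := by exact_mod_cast ha
  obtain ⟨l, rfl⟩ := Nat.exists_eq_add_of_le hi
  have hkl : (1 : ℝ) ≤ (k : ℝ) ^ l := one_le_pow₀ hk1
  have hnk : (n : ℝ) ≤ n * k ^ l := le_mul_of_one_le_right (Nat.cast_nonneg n) hkl
  have hlnk : 0 ≤ (l : ℝ) * (n * k ^ l) := by positivity
  calc ((k ^ (2 + l) + a + ((2 + l) * k ^ (2 + l - 1) + a) : ℕ) : ℝ)
      = (k : ℝ) ^ (2 + l) + (2 + l) * k ^ (1 + l) + 2 * a := by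
        rw [show 2 + l - 1 = 1 + l by omega]
        push_cast
        ring
    _ ≤ (k : ℝ) ^ (2 + l) + (2 + l) * k ^ (1 + l) + (2 + l) * (2 * (n * k ^ l)) := by linarith
    _ = (k : ℝ) ^ (2 + l) * (((2 + l : ℕ) : ℝ) * (1 / k + 2 * n / k ^ 2) + 1) := by
        push_cast
        field_simp
        ring
    _ ≤ (k : ℝ) ^ (2 + l) * Real.exp (((2 + l : ℕ) : ℝ) * (1 / k + 2 * n / k ^ 2)) := by
        gcongr
        exact Real.add_one_le_exp _
    _ = ((k : ℝ) * Real.exp (1 / k + 2 * n / k ^ 2)) ^ (2 + l) := by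
        rw [mul_pow, ← Real.exp_nat_mul]

variable [DecidableEq V]

@[simp]
lemma mem_fixedSet : v ∈ fixedSet c ↔ c v = v := by simp [fixedSet]

lemma apply_mem_fixedSet_iff (c : Equiv.Perm V) (v : V) : c v ∈ fixedSet c ↔ v ∈ fixedSet c := by
  simp [c.injective.eq_iff]

lemma card_compatiblePairs_fixedSet_union_le (D : Finset V) (hD : ∀ v, c v ∈ D ↔ v ∈ D)
    (hDF : ∀ v ∈ D, c v ≠ v) :
    (#(compatiblePairs e c k (fixedSet c ∪ D)) : ℝ) ≤ #(compatiblePairs e c k (fixedSet c)) *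
      ((k : ℝ) * Real.exp (1 / k + 2 * Fintype.card V / k ^ 2)) ^ #D := by
  induction D using Finset.strongInduction with
  | H D ih =>
    rcases D.eq_empty_or_nonempty with rfl | ⟨z, hz⟩
    · simp
    set Z := cycleThrough c z
    have hzZ : z ∈ Z := self_mem_cycleThrough c z
    have hZD : Z ⊆ D := cycleThrough_subset hD hz
    have hDZ (v : V) : c v ∈ D \ Z ↔ v ∈ D \ Z := by
      rw [mem_sdiff, mem_sdiff, hD, apply_mem_cycleThrough_iff]
    have hA (v : V) : c v ∈ fixedSet c ∪ D \ Z ↔ v ∈ fixedSet c ∪ D \ Z := by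
      rw [mem_union, mem_union, hDZ, apply_mem_fixedSet_iff]
    have hZcard : 2 ≤ #Z :=
      one_lt_card.2 ⟨z, hzZ, c z, (apply_mem_cycleThrough_iff c z z).2 hzZ, (hDF z hz).symm⟩
    have ih' := ih (D \ Z) (sdiff_ssubset hZD ⟨z, hzZ⟩) hDZ
      fun v hv => hDF v (mem_sdiff.1 hv).1
    have hstep := (Nat.cast_le (α := ℝ)).2
      (card_compatiblePairs_union_cycleThrough_le (e := e) (k := k) (z := z) hA)
    rw [union_assoc, sdiff_union_of_subset hZD, Nat.cast_mul, mul_comm] at hstep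
    rw [← card_sdiff_add_card_eq_card hZD, pow_add, ← mul_assoc]
    exact hstep.trans (mul_le_mul ih' (cycle_factor_le (NeZero.pos k) hZcard (card_le_univ _))
      (by positivity) (by positivity))

theorem card_compatiblePairs_univ_le :
    (#(compatiblePairs e c k univ) : ℝ) ≤ orientedFactorial e k #(fixedSet c) *
      ((k : ℝ) * Real.exp (1 / k + 2 * Fintype.card V / k ^ 2)) ^
        (Fintype.card V - #(fixedSet c)) := by
  have h := card_compatiblePairs_fixedSet_union_le (e := e) (k := k) (c := c) (fixedSet c)ᶜ
    (by simp [c.injective.eq_iff]) (by simp)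
  rw [union_compl, card_compl] at h
  refine h.trans (mul_le_mul_of_nonneg_right ?_ (by positivity))
  exact_mod_cast card_compatiblePairs_le_orientedFactorial (by simp)

end

/-! ### Sorting compatible pairs -/

/-- The word `w` is weakly increasing, and strictly so at every step outside `W`. -/
def IsStrictOutside {α : Type*} [Preorder α] {n : ℕ} (W : Finset (Fin n))
    (w : Fin (n + 1) → α) : Prop :=
  ∀ i : Fin n, w i.castSucc ≤ w i.succ ∧ (i ∉ W → w i.castSucc < w i.succ)

/-- The number of steps in `W` before the position `i`. -/
def weakBefore {n : ℕ} (W : Finset (Fin n)) (i : Fin (n + 1)) : ℕ :=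
  #{j ∈ W | j.castSucc < i}

open Classical in
/-- The steps of `π` at which a word that is compatible with `π` may stay constant. -/
noncomputable def weakStepSet {n : ℕ} (e : Bool) (π : Equiv.Perm (Fin (n + 1))) :
    Finset (Fin n) :=
  {i | orient e (· < ·) (π i.castSucc) (π i.succ)}

/-- The number of ascents (`e = true`) or of descents (`e = false`) of `π`. -/
def weakSteps {n : ℕ} (e : Bool) (π : Equiv.Perm (Fin (n + 1))) : ℕ :=
  if e then n - descentNumber π else descentNumber π

section words

variable {n : ℕ} (W : Finset (Fin n))

lemma weakBefore_zero : weakBefore W 0 = 0 := by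
  simp [weakBefore]

lemma weakBefore_last : weakBefore W (Fin.last n) = #W := by
  simp [weakBefore, Fin.castSucc_lt_last]

lemma weakBefore_succ (i : Fin n) :
    weakBefore W i.succ = weakBefore W i.castSucc + if i ∈ W then 1 else 0 := by
  have hsplit : {j ∈ W | j.castSucc < i.succ} =
      {j ∈ W | j.castSucc < i.castSucc} ∪ {j ∈ W | j = i} := by
    rw [← filter_or]
    exact filter_congr fun j _ => by
      rw [Fin.castSucc_lt_succ_iff, Fin.castSucc_lt_castSucc_iff, le_iff_lt_or_eq]
  rw [weakBefore, hsplit, card_union_of_disjoint, filter_eq']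
  · split_ifs <;> rfl
  · exact disjoint_filter.2 fun j _ hlt heq => hlt.ne (congrArg _ heq)

lemma weakBefore_le_card (i : Fin (n + 1)) : weakBefore W i ≤ #W :=
  card_filter_le _ _

variable {W}

lemma isStrictOutside_iff_strictMono_add_weakBefore {w : Fin (n + 1) → ℕ} :
    IsStrictOutside W w ↔ StrictMono fun i => w i + weakBefore W i := by
  rw [Fin.strictMono_iff_lt_succ]
  refine forall_congr' fun i => ?_
  rw [weakBefore_succ]
  by_cases hi : i ∈ W
  · simp only [hi, if_true, not_true, false_imp_iff, and_true]
    omega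
  · simp only [hi, if_false, not_false_eq_true, true_imp_iff]
    omega

lemma weakBefore_le_of_strictMono {w : Fin (n + 1) → ℕ} (hw : StrictMono w) (i : Fin (n + 1)) :
    weakBefore W i ≤ w i := by
  induction i using Fin.induction with
  | zero => simp [weakBefore_zero]
  | succ i ih =>
    have hlt : w i.castSucc < w i.succ := hw Fin.castSucc_lt_succ
    rw [weakBefore_succ]
    split_ifs <;> omega

lemma IsStrictOutside.monotone {α : Type*} [Preorder α] {w : Fin (n + 1) → α}
    (hw : IsStrictOutside W w) : Monotone w :=
  Fin.monotone_iff_le_succ.2 fun i => (hw i).1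

lemma exists_word_add_weakBefore_eq {k : ℕ} (g : Fin (n + 1) ↪o Fin (k + #W)) :
    ∃ w : Fin (n + 1) → Fin k,
      IsStrictOutside W w ∧ ∀ i, (w i : ℕ) + weakBefore W i = g i := by
  have hg : StrictMono fun i => (g i : ℕ) := fun _ _ hij => g.strictMono hij
  have hadd (i) : (g i : ℕ) - weakBefore W i + weakBefore W i = g i :=
    Nat.sub_add_cancel (weakBefore_le_of_strictMono hg i)
  have hstrict : IsStrictOutside W fun i => (g i : ℕ) - weakBefore W i :=
    isStrictOutside_iff_strictMono_add_weakBefore.2 (by simpa only [hadd] using hg)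
  have hlt (i) : (g i : ℕ) - weakBefore W i < k := by
    have hlast := hadd (Fin.last n)
    rw [weakBefore_last] at hlast
    have hle := hstrict.monotone (Fin.le_last i)
    simp only [weakBefore_last] at hle
    omega
  exact ⟨fun i => ⟨g i - weakBefore W i, hlt i⟩, hstrict, hadd⟩

-- Adding `weakBefore W` makes all steps strict, so the words correspond to `(n + 1)`-subsets.
lemma natCard_isStrictOutside (k : ℕ) (W : Finset (Fin n)) :
    Nat.card {w : Fin (n + 1) → Fin k // IsStrictOutside W w} = (k + #W).choose (n + 1) := by
  let shift (w : {w : Fin (n + 1) → Fin k // IsStrictOutside W w}) :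
      Fin (n + 1) ↪o Fin (k + #W) :=
    OrderEmbedding.ofStrictMono
      (fun i => ⟨w.1 i + weakBefore W i, Nat.add_lt_add_of_lt_of_le (w.1 i).2
        (weakBefore_le_card W i)⟩)
      (isStrictOutside_iff_strictMono_add_weakBefore (w := fun i => (w.1 i : ℕ)).1 w.2)
  have hshift : Function.Bijective shift := by
    refine ⟨fun w w' h => Subtype.ext (funext fun i => Fin.ext ?_), fun g => ?_⟩
    · exact Nat.add_right_cancel (congrArg Fin.val (DFunLike.congr_fun h i))
    · obtain ⟨w, hw, hwg⟩ := exists_word_add_weakBefore_eq g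
      exact ⟨⟨w, hw⟩, RelEmbedding.ext fun i => Fin.ext (hwg i)⟩
  rw [Nat.card_eq_of_bijective shift hshift,
    Nat.card_congr Set.powersetCard.ofFinEmbEquiv, Set.powersetCard.card, Nat.card_fin]

end words

lemma orient_trans {α : Type*} {e : Bool} {r : α → α → Prop} [IsTrans α r] {a b c : α}
    (hab : orient e r a b) (hbc : orient e r b c) : orient e r a c := by
  cases e
  · exact trans_of r hbc hab
  · exact trans_of r hab hbc

lemma orient_asymm {α : Type*} {e : Bool} {r : α → α → Prop} [Std.Asymm r] {a b : α}
    (h : orient e r a b) : ¬ orient e r b a := by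
  cases e <;> exact asymm_of r h

lemma exists_equiv_fin_rel_iff_lt {V : Type*} [Fintype V] (r : V → V → Prop)
    [IsStrictTotalOrder V r] {m : ℕ} (hm : Fintype.card V = m) :
    ∃ σ : V ≃ Fin m, ∀ u v, r u v ↔ σ u < σ v := by
  classical
  let _ := linearOrderOfSTO r
  exact ⟨(monoEquivOfFin V hm).symm.toEquiv, fun _ _ => (monoEquivOfFin V hm).symm.lt_iff_lt.symm⟩

lemma equiv_fin_ext_of_lt_iff {V : Type*} {m : ℕ} {σ τ : V ≃ Fin m}
    (h : ∀ u v, σ u < σ v ↔ τ u < τ v) : σ = τ := by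
  have hmono : StrictMono (σ.symm.trans τ) := fun a b hab => (h _ _).1 (by simpa using hab)
  have hid : ⇑(σ.symm.trans τ) = id :=
    (hmono.range_inj strictMono_id).1 ((σ.symm.trans τ).surjective.range_eq.trans Set.range_id.symm)
  exact Equiv.ext fun v => by simpa using (congrFun hid (σ v)).symm

section sorting

variable {n k : ℕ} {e : Bool} {c π σ : Equiv.Perm (Fin (n + 1))} {w : Fin (n + 1) → Fin k}

lemma mem_weakStepSet {i : Fin n} :
    i ∈ weakStepSet e π ↔ orient e (· < ·) (π i.castSucc) (π i.succ) := by
  simp [weakStepSet]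

lemma orient_of_isStrictOutside (hw : IsStrictOutside (weakStepSet e π) w) {i j : Fin (n + 1)}
    (hij : i < j) (h : w i = w j) : orient e (· < ·) (π i) (π j) := by
  induction j using Fin.induction with
  | zero => simp at hij
  | succ j ih =>
    have hij' : i ≤ j.castSucc := Fin.le_castSucc_iff.2 hij
    have hconst : w j.castSucc = w j.succ := (hw j).1.antisymm (h ▸ hw.monotone hij')
    have hstep : orient e (· < ·) (π j.castSucc) (π j.succ) :=
      mem_weakStepSet.1 (of_not_not fun hj => ((hw j).2 hj).ne hconst)
    rcases hij'.eq_or_lt with rfl | hlt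
    · exact hstep
    · exact orient_trans (ih hlt (h.trans hconst.symm)) hstep

variable [NeZero k]

lemma isStrictOutside_of_isCompatible
    (h : IsCompatible e c univ (fun u v => σ u < σ v) (fun v => w (σ v))) :
    IsStrictOutside (weakStepSet e (σ * c * σ⁻¹)) w := fun i => by
  have hle : w i.castSucc ≤ w i.succ := le_of_not_gt fun hlt => by
    have hrel := h.rel_of_color_lt (u := σ⁻¹ i.succ) (v := σ⁻¹ i.castSucc) (mem_univ _)
      (mem_univ _) (by simpa using hlt)
    exact Fin.castSucc_lt_succ.asymm (by simpa using hrel)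
  refine ⟨hle, fun hi => hle.lt_of_ne fun heq => hi (mem_weakStepSet.2 ?_)⟩
  have hrel := h.rel_iff_orient (u := σ⁻¹ i.castSucc) (v := σ⁻¹ i.succ) (mem_univ _) (mem_univ _)
    (by simpa using heq)
  simpa [orient, Equiv.Perm.mul_apply] using hrel

lemma isCompatible_of_isStrictOutside (hw : IsStrictOutside (weakStepSet e (σ * c * σ⁻¹)) w) :
    IsCompatible e c univ (fun u v => σ u < σ v) (fun v => w (σ v)) where
  mem_of_rel _ := ⟨mem_univ _, mem_univ _⟩
  color_eq_zero hv := absurd (mem_univ _) hv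
  irrefl _ := lt_irrefl _
  trans h₁ h₂ := h₁.trans h₂
  total _ _ huv := lt_or_gt_of_ne (σ.injective.ne huv)
  rel_of_color_lt _ _ hlt := hw.monotone.reflect_lt hlt
  rel_iff_orient {u v} _ _ heq := by
    have orient_image {u v} (hlt : σ u < σ v) (heq : w (σ u) = w (σ v)) :
        orient e (fun u v => σ u < σ v) (c u) (c v) := by
      simpa [orient, Equiv.Perm.mul_apply] using orient_of_isStrictOutside hw hlt heq
    have : Std.Asymm fun u v => σ u < σ v := ⟨fun _ _ => lt_asymm⟩
    refine ⟨fun hlt => orient_image hlt heq, fun h => not_le.1 fun hle => ?_⟩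
    rcases hle.eq_or_lt with hvu | hvu
    · rw [σ.injective hvu] at h
      exact orient_asymm h h
    · exact orient_asymm h (orient_image hvu heq.symm)

lemma exists_perm_of_isCompatible {r : Fin (n + 1) → Fin (n + 1) → Prop} {f : Fin (n + 1) → Fin k}
    (h : IsCompatible e c univ r f) :
    ∃ σ : Equiv.Perm (Fin (n + 1)), r = fun u v => σ u < σ v := by
  have : IsStrictTotalOrder (Fin (n + 1)) r :=
    { trichotomous u v huv hvu := of_not_not fun hne =>
        (h.total (mem_univ u) (mem_univ v) hne).elim huv hvu
      irrefl := h.irrefl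
      trans _ _ _ := h.trans }
  obtain ⟨σ, hσ⟩ := exists_equiv_fin_rel_iff_lt r (Fintype.card_fin (n + 1))
  exact ⟨σ, funext₂ fun u v => propext (hσ u v)⟩

theorem card_compatiblePairs_eq_sum_card_weakStepSet (c : Equiv.Perm (Fin (n + 1))) :
    #(compatiblePairs e c k univ) = ∑ σ : Equiv.Perm (Fin (n + 1)),
      (k + #(weakStepSet e (σ * c * σ⁻¹))).choose (n + 1) := by
  let colored (x : Σ σ : Equiv.Perm (Fin (n + 1)),
      {w : Fin (n + 1) → Fin k // IsStrictOutside (weakStepSet e (σ * c * σ⁻¹)) w}) :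
      compatiblePairs e c k univ :=
    ⟨(fun u v => x.1 u < x.1 v, fun v => x.2.1 (x.1 v)),
      mem_compatiblePairs.2 (isCompatible_of_isStrictOutside x.2.2)⟩
  have hinj : Function.Injective colored := by
    rintro ⟨σ, w, hw⟩ ⟨τ, w', hw'⟩ h
    obtain ⟨hrel, hcol⟩ := Prod.ext_iff.1 (congrArg Subtype.val h)
    obtain rfl : σ = τ := equiv_fin_ext_of_lt_iff fun u v => iff_of_eq (congrFun₂ hrel u v)
    obtain rfl : w = w' := σ.surjective.injective_comp_right hcol
    rfl
  have hsurj : Function.Surjective colored := by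
    rintro ⟨⟨r, f⟩, hp⟩
    obtain ⟨σ, rfl⟩ := exists_perm_of_isCompatible (mem_compatiblePairs.1 hp)
    obtain ⟨w, rfl⟩ : ∃ w, f = fun v => w (σ v) := ⟨f ∘ σ.symm, by simp⟩
    exact ⟨⟨σ, w, isStrictOutside_of_isCompatible (mem_compatiblePairs.1 hp)⟩, rfl⟩
  rw [← Nat.card_eq_finsetCard, ← Nat.card_eq_of_bijective colored ⟨hinj, hsurj⟩, Nat.card_sigma]
  simp only [natCard_isStrictOutside]

lemma descentNumber_eq_card_castSucc (π : Equiv.Perm (Fin (n + 1))) :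
    descentNumber π = #{i : Fin n | π i.succ < π i.castSucc} := by
  rw [← card_map Fin.castSuccEmb, descentNumber, descentSet]
  congr 1
  ext i
  simp only [mem_filter, mem_univ, true_and, mem_map, Fin.coe_castSuccEmb]
  constructor
  · rintro ⟨h, hlt⟩
    exact ⟨⟨i, by omega⟩, hlt, rfl⟩
  · rintro ⟨j, hj, rfl⟩
    exact ⟨by simp, hj⟩

lemma descentNumber_le (π : Equiv.Perm (Fin (n + 1))) : descentNumber π ≤ n := by
  rw [descentNumber_eq_card_castSucc]
  exact (card_le_univ _).trans_eq (Fintype.card_fin n)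

lemma card_weakStepSet (e : Bool) (π : Equiv.Perm (Fin (n + 1))) :
    #(weakStepSet e π) = weakSteps e π := by
  cases e with
  | false => simp [weakStepSet, weakSteps, descentNumber_eq_card_castSucc]
  | true =>
    have hcompl : weakStepSet true π = ({i : Fin n | π i.succ < π i.castSucc} : Finset _)ᶜ := by
      ext i
      have hne : π i.castSucc ≠ π i.succ := π.injective.ne Fin.castSucc_lt_succ.ne
      simp [mem_weakStepSet, hne.le_iff_lt]
    rw [hcompl, card_compl, Fintype.card_fin, weakSteps, if_pos rfl, descentNumber_eq_card_castSucc]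

theorem card_compatiblePairs_eq_sum_choose (c : Equiv.Perm (Fin (n + 1))) :
    #(compatiblePairs e c k univ) = ∑ σ : Equiv.Perm (Fin (n + 1)),
      (k + weakSteps e (σ * c * σ⁻¹)).choose (n + 1) := by
  simp only [card_compatiblePairs_eq_sum_card_weakStepSet, card_weakStepSet]

end sorting

/-! ### Lower bound: separating colorings -/

/-- The coloring `g` distinguishes any two points within two steps of `c`. -/
def IsSeparating {X : Type*} {k : ℕ} (c : Equiv.Perm X) (g : X → Fin k) : Prop :=
  ∀ u v, u ≠ v → g u = g v → g (c u) ≠ g (c v)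

section coloringCount

variable {X : Type*} [Fintype X] {k : ℕ}

lemma card_mul_pow_le_of_eqOn_compl_injective {t : Finset (X → Fin k)} (S : Finset X)
    (ht : ∀ g ∈ t, ∀ g' ∈ t, (∀ x ∉ S, g x = g' x) → g = g') :
    #t * k ^ #S ≤ k ^ Fintype.card X := by
  classical
  have hcard : #t ≤ #(univ : Finset ({x // x ∉ S} → Fin k)) :=
    card_le_card_of_injOn (fun g x => g x) (fun _ _ => mem_univ _) fun g hg g' hg' h =>
      ht g hg g' hg' fun x hx => congrFun h ⟨x, hx⟩
  rw [card_univ, Fintype.card_fun, Fintype.card_fin, Fintype.card_subtype_compl,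
    Fintype.card_coe] at hcard
  calc #t * k ^ #S ≤ k ^ (Fintype.card X - #S) * k ^ #S := Nat.mul_le_mul_right _ hcard
    _ = k ^ Fintype.card X := by rw [← pow_add, Nat.sub_add_cancel S.card_le_univ]

section

variable [DecidableEq X]

lemma card_coloring_eq_mul_le {a b : X} (hab : a ≠ b) :
    #{g : X → Fin k | g a = g b} * k ≤ k ^ Fintype.card X := by
  suffices #{g : X → Fin k | g a = g b} * k ^ #{a} ≤ k ^ Fintype.card X by simpa using this
  refine card_mul_pow_le_of_eqOn_compl_injective {a} fun g hg g' hg' h => funext fun x => ?_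
  rcases eq_or_ne x a with rfl | hx
  · rw [(mem_filter.1 hg).2, (mem_filter.1 hg').2, h b (by simpa using hab.symm)]
  · exact h x (by simpa using hx)

lemma card_coloring_eq_and_eq_mul_le {a a' b b' : X} (haa' : a ≠ a') (hba : b ≠ a) (hba' : b ≠ a')
    (hb'a : b' ≠ a) (hb'a' : b' ≠ a') :
    #{g : X → Fin k | g a = g b ∧ g a' = g b'} * k ^ 2 ≤ k ^ Fintype.card X := by
  rw [← card_pair haa']
  refine card_mul_pow_le_of_eqOn_compl_injective {a, a'} fun g hg g' hg' h => funext fun x => ?_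
  obtain ⟨hgb, hgb'⟩ := (mem_filter.1 hg).2
  obtain ⟨hg'b, hg'b'⟩ := (mem_filter.1 hg').2
  rcases eq_or_ne x a with rfl | hxa
  · rw [hgb, hg'b, h b (by simp [hba, hba'])]
  rcases eq_or_ne x a' with rfl | hxa'
  · rw [hgb', hg'b', h b' (by simp [hb'a, hb'a'])]
  · exact h x (by simp [hxa, hxa'])

open Classical in
lemma filter_not_isSeparating_subset (c : Equiv.Perm X) :
    ({g | ¬ IsSeparating c g} : Finset (X → Fin k)) ⊆
      (univ.biUnion fun u => {g | g u = g (c u)}) ∪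
        ({a | a.1 ≠ a.2 ∧ a.2 ≠ c a.1 ∧ a.1 ≠ c a.2} : Finset (X × X)).biUnion
          fun a => {g | g a.1 = g a.2 ∧ g (c a.1) = g (c a.2)} := fun g hg => by
  simp only [mem_filter, mem_univ, true_and, IsSeparating, not_forall, not_not] at hg
  obtain ⟨u, v, huv, hg₁, hg₂⟩ := hg
  simp only [mem_union, mem_biUnion, mem_filter, mem_univ, true_and, Prod.exists]
  by_cases hv : v = c u
  · exact .inl ⟨u, hv ▸ hg₁⟩
  by_cases hu : u = c v
  · exact .inl ⟨v, hu ▸ hg₁.symm⟩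
  · exact .inr ⟨u, v, ⟨huv, hv, hu⟩, hg₁, hg₂⟩

open Classical in
lemma card_not_isSeparating_le [NeZero k] (c : Equiv.Perm X) (hc : ∀ v, c v ≠ v) :
    (#{g : X → Fin k | ¬ IsSeparating c g} : ℝ) ≤
      Fintype.card X * ((k : ℝ) ^ Fintype.card X / k) +
        Fintype.card X ^ 2 * ((k : ℝ) ^ Fintype.card X / k ^ 2) := by
  have hk : (0 : ℝ) < k := by exact_mod_cast NeZero.pos k
  set P : Finset (X × X) := {a | a.1 ≠ a.2 ∧ a.2 ≠ c a.1 ∧ a.1 ≠ c a.2}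
  have hP : (#P : ℝ) ≤ Fintype.card X ^ 2 := by
    exact_mod_cast P.card_le_univ.trans_eq (by rw [Fintype.card_prod, sq])
  have adjacent (u : X) :
      (#{g : X → Fin k | g u = g (c u)} : ℝ) ≤ (k : ℝ) ^ Fintype.card X / k := by
    rw [le_div_iff₀ hk]
    exact_mod_cast card_coloring_eq_mul_le (hc u).symm
  have distant (a) (ha : a ∈ P) : (#{g : X → Fin k | g a.1 = g a.2 ∧ g (c a.1) = g (c a.2)} : ℝ) ≤
      (k : ℝ) ^ Fintype.card X / k ^ 2 := by
    obtain ⟨hne, hne₂, hne₁⟩ := (mem_filter.1 ha).2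
    rw [le_div_iff₀ (by positivity)]
    exact_mod_cast card_coloring_eq_and_eq_mul_le (hc _).symm hne.symm hne₂ hne₁.symm
      (c.injective.ne hne.symm)
  have hsplit := (card_le_card (filter_not_isSeparating_subset (k := k) c)).trans
    ((card_union_le _ _).trans (Nat.add_le_add card_biUnion_le card_biUnion_le))
  calc (#{g : X → Fin k | ¬ IsSeparating c g} : ℝ)
      ≤ ∑ u, (#{g : X → Fin k | g u = g (c u)} : ℝ) +
          ∑ a ∈ P, (#{g : X → Fin k | g a.1 = g a.2 ∧ g (c a.1) = g (c a.2)} : ℝ) := by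
        exact_mod_cast hsplit
    _ ≤ ∑ _u : X, (k : ℝ) ^ Fintype.card X / k + ∑ _a ∈ P, (k : ℝ) ^ Fintype.card X / k ^ 2 :=
        add_le_add (sum_le_sum fun u _ => adjacent u) (sum_le_sum distant)
    _ = Fintype.card X * ((k : ℝ) ^ Fintype.card X / k) +
          #P * ((k : ℝ) ^ Fintype.card X / k ^ 2) := by simp
    _ ≤ _ := by gcongr

end

lemma le_natCard_isSeparating [NeZero k] (c : Equiv.Perm X) (hc : ∀ v, c v ≠ v) :
    (k : ℝ) ^ Fintype.card X * (1 - Fintype.card X / k - (Fintype.card X : ℝ) ^ 2 / k ^ 2) ≤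
      Nat.card {g : X → Fin k // IsSeparating c g} := by
  classical
  have hbad := card_not_isSeparating_le (k := k) c hc
  have htotal : (#{g : X → Fin k | IsSeparating c g} : ℝ) + #{g : X → Fin k | ¬ IsSeparating c g} =
      (k : ℝ) ^ Fintype.card X := by
    exact_mod_cast (card_filter_add_card_filter_not _).trans (by simp)
  rw [Nat.card_eq_fintype_card, Fintype.card_subtype]
  calc _ = (k : ℝ) ^ Fintype.card X - (Fintype.card X * ((k : ℝ) ^ Fintype.card X / k) +
        Fintype.card X ^ 2 * ((k : ℝ) ^ Fintype.card X / k ^ 2)) := by ring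
    _ ≤ _ := by linarith

end coloringCount

/-- A word allowed on the fixed points: weakly (`e = true`) or strictly (`e = false`)
increasing. -/
def IsFixedWord {m k : ℕ} (e : Bool) (w : Fin m → Fin k) : Prop :=
  Monotone w ∧ (e = false → StrictMono w)

lemma isFixedWord_iff_isStrictOutside {n k : ℕ} {e : Bool} {w : Fin (n + 1) → Fin k} :
    IsFixedWord e w ↔ IsStrictOutside (if e then univ else ∅) w := by
  rw [IsFixedWord, Fin.monotone_iff_le_succ, Fin.strictMono_iff_lt_succ, IsStrictOutside,
    forall_and]
  cases e <;> simp

lemma factorial_mul_natCard_isFixedWord (e : Bool) (m k : ℕ) :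
    m.factorial * Nat.card {w : Fin m → Fin k // IsFixedWord e w} = orientedFactorial e k m := by
  cases m with
  | zero =>
    have hall (w : Fin 0 → Fin k) : IsFixedWord e w := ⟨fun a => a.elim0, fun _ a => a.elim0⟩
    cases e <;> simp [hall, orientedFactorial]
  | succ n =>
    simp only [isFixedWord_iff_isStrictOutside, natCard_isStrictOutside]
    cases e with
    | true => simp [orientedFactorial, Nat.ascFactorial_eq_factorial_mul_choose', ← add_assoc]
    | false =>
      rw [orientedFactorial, if_neg Bool.false_ne_true, Nat.descFactorial_eq_factorial_mul_choose]
      simp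

/-- The color sequence along the orbit of `v`, with alternating signs when `e = false`, as an
element of the lexicographically ordered space of sequences. -/
def signedWord {V : Type*} {k : ℕ} (e : Bool) (c : Equiv.Perm V) (f : V → Fin k) (v : V) :
    Lex (ℕ → ℤ) :=
  toLex fun j => (if e then 1 else -1) ^ j * ((f ((c ^ j) v) : ℕ) : ℤ)

/-- The order by signed words, with ties broken by `t`. -/
def wordOrder {V : Type*} {k : ℕ} (e : Bool) (c : Equiv.Perm V) (f : V → Fin k) (t : V → ℕ)
    (u v : V) : Prop :=
  toLex (signedWord e c f u, t u) < toLex (signedWord e c f v, t v)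

section wordOrder

variable {V : Type*} {k : ℕ} {e : Bool} {c : Equiv.Perm V} {f : V → Fin k} {t : V → ℕ} {u v : V}

lemma signedWord_eq_iff : signedWord e c f u = signedWord e c f v ↔ SameWord c f u v := by
  rw [signedWord, signedWord, toLex_inj, funext_iff, SameWord]
  refine forall_congr' fun j => ?_
  rw [mul_right_inj' (by cases e <;> simp), Int.natCast_inj, Fin.val_inj]

lemma signedWord_apply (e : Bool) (c : Equiv.Perm V) (f : V → Fin k) (v : V) (j : ℕ) :
    ofLex (signedWord e c f (c v)) j =
      (if e then 1 else -1) * ofLex (signedWord e c f v) (j + 1) := by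
  have hsign : (if e then 1 else -1 : ℤ) * (if e then 1 else -1) = 1 := by cases e <;> rfl
  simp only [signedWord, ofLex_toLex, pow_succ', Equiv.Perm.mul_apply, ← mul_assoc, hsign, one_mul]
  rw [← Equiv.Perm.mul_apply, ← Equiv.Perm.mul_apply, ← pow_succ, ← pow_succ']

lemma signedWord_lt_of_color_lt (h : f u < f v) : signedWord e c f u < signedWord e c f v :=
  ⟨0, by simp, by simpa [signedWord] using h⟩

lemma orient_signedWord_apply (h : f u = f v) (hlt : signedWord e c f u < signedWord e c f v) :
    orient e (· < ·) (signedWord e c f (c u)) (signedWord e c f (c v)) := by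
  obtain ⟨_ | j, heq, hlt⟩ := hlt
  · exact absurd hlt (by simp [signedWord, h])
  have heq' (i : ℕ) (hi : i < j) :
      ofLex (signedWord e c f (c u)) i = ofLex (signedWord e c f (c v)) i := by
    rw [signedWord_apply, signedWord_apply]
    exact congrArg _ (heq (i + 1) (Nat.succ_lt_succ hi))
  have hlt' : ofLex (signedWord e c f u) (j + 1) < ofLex (signedWord e c f v) (j + 1) := hlt
  cases e with
  | true =>
    refine ⟨j, heq', ?_⟩
    change ofLex (signedWord true c f (c u)) j < ofLex (signedWord true c f (c v)) j
    simpa only [signedWord_apply, if_true, one_mul] using hlt'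
  | false =>
    refine ⟨j, fun i hi => (heq' i hi).symm, ?_⟩
    change ofLex (signedWord false c f (c v)) j < ofLex (signedWord false c f (c u)) j
    simpa only [signedWord_apply, Bool.false_eq_true, if_false, neg_one_mul, neg_lt_neg_iff]
      using hlt'

lemma signedWord_lt_iff_orient_apply (h : f u = f v) (hne : ¬ SameWord c f u v) :
    signedWord e c f u < signedWord e c f v ↔
      orient e (· < ·) (signedWord e c f (c u)) (signedWord e c f (c v)) := by
  refine ⟨orient_signedWord_apply h, fun hlt => not_le.1 fun hle => ?_⟩
  exact orient_asymm hlt (orient_signedWord_apply h.symm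
    (hle.lt_of_ne fun heq => hne (signedWord_eq_iff.1 heq).symm))

lemma wordOrder_iff_of_not_sameWord (hne : ¬ SameWord c f u v) :
    wordOrder e c f t u v ↔ signedWord e c f u < signedWord e c f v := by
  rw [← signedWord_eq_iff (e := e)] at hne
  simp [wordOrder, Prod.Lex.toLex_lt_toLex, hne]

lemma isCompatible_wordOrder [Fintype V] [NeZero k]
    (hsep : ∀ u v, u ≠ v → ¬ (c u = u ∧ c v = v) → ¬ SameWord c f u v)
    (ht : ∀ u v, c u = u → c v = v → t u = t v → u = v)
    (hfix : e = false → ∀ u v, c u = u → c v = v → f u = f v → u = v) :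
    IsCompatible e c univ (wordOrder e c f t) f where
  mem_of_rel _ := ⟨mem_univ _, mem_univ _⟩
  color_eq_zero hv := absurd (mem_univ _) hv
  irrefl _ := lt_irrefl _
  trans h₁ h₂ := lt_trans h₁ h₂
  total {u v} _ _ huv := by
    refine lt_or_gt_of_ne fun heq => ?_
    obtain ⟨hword, htie⟩ := Prod.ext_iff.1 (toLex_inj.1 heq)
    refine hsep u v huv (fun ⟨hu, hv⟩ => huv (ht u v hu hv htie)) (signedWord_eq_iff.1 hword)
  rel_of_color_lt _ _ h := Prod.Lex.toLex_lt_toLex.2 (.inl (signedWord_lt_of_color_lt h))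
  rel_iff_orient {u v} _ _ heq := by
    rcases eq_or_ne u v with rfl | huv
    · cases e <;> exact iff_of_false (lt_irrefl _) (lt_irrefl _)
    by_cases hfixed : c u = u ∧ c v = v
    · cases e with
      | true => rw [orient_true, hfixed.1, hfixed.2]
      | false => exact absurd (hfix rfl u v hfixed.1 hfixed.2 heq) huv
    have hword := hsep u v huv hfixed
    have hword' := hsep (c u) (c v) (c.injective.ne huv)
      (by rwa [c.injective.eq_iff, c.injective.eq_iff])
    have horient : orient e (wordOrder e c f t) (c u) (c v) ↔
        orient e (· < ·) (signedWord e c f (c u)) (signedWord e c f (c v)) := by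
      cases e with
      | true => exact wordOrder_iff_of_not_sameWord hword'
      | false => exact wordOrder_iff_of_not_sameWord fun h => hword' h.symm
    rw [wordOrder_iff_of_not_sameWord hword, horient]
    exact signedWord_lt_iff_orient_apply heq hword

end wordOrder

/-- The coloring that is `w` on the fixed points, listed by `s`, and `g` elsewhere. -/
def glueColor {V : Type*} [DecidableEq V] {m k : ℕ} (c : Equiv.Perm V) (s : {v // c v = v} ≃ Fin m)
    (w : Fin m → Fin k) (g : {v // c v ≠ v} → Fin k) (v : V) : Fin k :=
  if h : c v = v then w (s ⟨v, h⟩) else g ⟨v, h⟩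

/-- The position of a fixed point in the list `s`, and `0` for the other points. -/
def glueTie {V : Type*} [DecidableEq V] {m : ℕ} (c : Equiv.Perm V) (s : {v // c v = v} ≃ Fin m)
    (v : V) : ℕ :=
  if h : c v = v then s ⟨v, h⟩ else 0

/-- The restriction of `c` to the points that it moves. -/
def movedPerm {V : Type*} (c : Equiv.Perm V) : Equiv.Perm {v // c v ≠ v} :=
  c.subtypePerm (p := fun v => c v ≠ v) fun v => by rw [Ne, c.injective.eq_iff]

section glue

variable {V : Type*} [DecidableEq V] {m k : ℕ} {e : Bool} {c : Equiv.Perm V}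
  {s : {v // c v = v} ≃ Fin m} {w : Fin m → Fin k} {g : {v // c v ≠ v} → Fin k} {u v : V}

@[simp]
lemma glueColor_fixed (v : {v // c v = v}) : glueColor c s w g v = w (s v) := by
  simp [glueColor, v.2]

@[simp]
lemma glueColor_moved (v : {v // c v ≠ v}) : glueColor c s w g v = g v := by
  simp [glueColor, v.2]

@[simp]
lemma glueTie_fixed (v : {v // c v = v}) : glueTie c s v = s v := by
  simp [glueTie, v.2]

lemma not_sameWord_glueColor_of_moved (hg : IsSeparating (movedPerm c) g) (huv : u ≠ v)
    (hu : c u ≠ u) (hv : c v ≠ v) : ¬ SameWord c (glueColor c s w g) u v := fun hs => by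
  have h₀ := hs.color_eq
  have h₁ := hs.apply.color_eq
  rw [glueColor_moved ⟨u, hu⟩, glueColor_moved ⟨v, hv⟩] at h₀
  rw [glueColor_moved ⟨c u, c.injective.ne hu⟩, glueColor_moved ⟨c v, c.injective.ne hv⟩] at h₁
  exact hg ⟨u, hu⟩ ⟨v, hv⟩ (fun h => huv (congrArg Subtype.val h)) h₀ h₁

-- A fixed point has a constant word, which would then also be the word of both `v` and `c v`.
lemma not_sameWord_glueColor_of_fixed_of_moved (hg : IsSeparating (movedPerm c) g)
    (hu : c u = u) (hv : c v ≠ v) : ¬ SameWord c (glueColor c s w g) u v := fun hs => by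
  have hs' := hs.apply
  rw [hu] at hs'
  exact not_sameWord_glueColor_of_moved hg hv.symm hv (c.injective.ne hv) (hs.symm.trans hs')

lemma not_sameWord_glueColor (hg : IsSeparating (movedPerm c) g) (huv : u ≠ v)
    (hfixed : ¬ (c u = u ∧ c v = v)) : ¬ SameWord c (glueColor c s w g) u v := by
  by_cases hu : c u = u
  · exact not_sameWord_glueColor_of_fixed_of_moved hg hu fun hv => hfixed ⟨hu, hv⟩
  by_cases hv : c v = v
  · exact fun hs => not_sameWord_glueColor_of_fixed_of_moved hg hv hu hs.symm
  · exact not_sameWord_glueColor_of_moved hg huv hu hv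

lemma wordOrder_glue_of_lt (hw : IsFixedWord e w) {u v : {v // c v = v}} (hlt : s u < s v) :
    wordOrder e c (glueColor c s w g) (glueTie c s) u v := by
  rcases (hw.1 hlt.le).lt_or_eq with h | h
  · exact Prod.Lex.toLex_lt_toLex.2 (.inl (signedWord_lt_of_color_lt (by simpa using h)))
  · refine Prod.Lex.toLex_lt_toLex.2 (.inr ⟨signedWord_eq_iff.2 fun j => ?_, by simpa using hlt⟩)
    rw [Equiv.Perm.pow_apply_eq_self_of_apply_eq_self u.2,
      Equiv.Perm.pow_apply_eq_self_of_apply_eq_self v.2, glueColor_fixed, glueColor_fixed, h]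

lemma wordOrder_glue_iff (hw : IsFixedWord e w) (u v : {v // c v = v}) :
    wordOrder e c (glueColor c s w g) (glueTie c s) u v ↔ s u < s v := by
  refine ⟨fun h => not_le.1 fun hle => ?_, wordOrder_glue_of_lt hw⟩
  rcases hle.lt_or_eq with hvu | hvu
  · exact lt_asymm h (wordOrder_glue_of_lt hw hvu)
  · rw [s.injective hvu] at h
    exact lt_irrefl _ h

variable [Fintype V] [NeZero k]

lemma isCompatible_glue (hw : IsFixedWord e w) (hg : IsSeparating (movedPerm c) g) :
    IsCompatible e c univ (wordOrder e c (glueColor c s w g) (glueTie c s))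
      (glueColor c s w g) := by
  refine isCompatible_wordOrder (fun u v => not_sameWord_glueColor hg) (fun u v hu hv h => ?_)
    fun he u v hu hv h => ?_
  · rw [glueTie_fixed ⟨u, hu⟩, glueTie_fixed ⟨v, hv⟩] at h
    exact congrArg Subtype.val (s.injective (Fin.val_injective h))
  · rw [glueColor_fixed ⟨u, hu⟩, glueColor_fixed ⟨v, hv⟩] at h
    exact congrArg Subtype.val (s.injective ((hw.2 he).injective h))

end glue

lemma natCard_mul_natCard_mul_natCard_le_card_compatiblePairs {V : Type*}
    [Fintype V] {m k : ℕ} [NeZero k] {e : Bool} {c : Equiv.Perm V} :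
    Nat.card ({v // c v = v} ≃ Fin m) * Nat.card {w : Fin m → Fin k // IsFixedWord e w} *
      Nat.card {g : {v // c v ≠ v} → Fin k // IsSeparating (movedPerm c) g} ≤
      #(compatiblePairs e c k univ) := by
  classical
  rw [← Nat.card_prod, ← Nat.card_prod, ← Nat.card_eq_finsetCard]
  let glue (x : (({v // c v = v} ≃ Fin m) × {w : Fin m → Fin k // IsFixedWord e w}) ×
      {g : {v // c v ≠ v} → Fin k // IsSeparating (movedPerm c) g}) :
      compatiblePairs e c k univ :=
    ⟨(wordOrder e c (glueColor c x.1.1 x.1.2.1 x.2.1) (glueTie c x.1.1),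
      glueColor c x.1.1 x.1.2.1 x.2.1), mem_compatiblePairs.2 (isCompatible_glue x.1.2.2 x.2.2)⟩
  refine Nat.card_le_card_of_injective glue ?_
  rintro ⟨⟨s, w, hw⟩, g, hg⟩ ⟨⟨s', w', hw'⟩, g', hg'⟩ h
  obtain ⟨hrel, hcol⟩ := Prod.ext_iff.1 (congrArg Subtype.val h)
  obtain rfl : s = s' := equiv_fin_ext_of_lt_iff fun u v => by
    rw [← wordOrder_glue_iff (g := g) hw, ← wordOrder_glue_iff (g := g') hw']
    exact iff_of_eq (congrFun₂ hrel u v)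
  obtain rfl : w = w' := funext fun i => by simpa [glue] using congrFun hcol (s.symm i)
  obtain rfl : g = g' := funext fun v => by simpa [glue] using congrFun hcol v
  rfl

theorem le_card_compatiblePairs_univ {V : Type*} [Fintype V] [DecidableEq V] {k : ℕ} [NeZero k]
    {e : Bool} {c : Equiv.Perm V} :
    orientedFactorial e k #(fixedSet c) * ((k : ℝ) ^ (Fintype.card V - #(fixedSet c)) *
      (1 - Fintype.card V / k - (Fintype.card V : ℝ) ^ 2 / k ^ 2)) ≤
      (#(compatiblePairs e c k univ) : ℝ) := by
  have hfixed : Fintype.card {v // c v = v} = #(fixedSet c) := Fintype.card_subtype _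
  have hmoved : Fintype.card {v // c v ≠ v} = Fintype.card V - #(fixedSet c) := by
    rw [← hfixed, ← Fintype.card_subtype_compl]
  have hpairs := natCard_mul_natCard_mul_natCard_le_card_compatiblePairs (e := e) (k := k) (c := c)
    (m := #(fixedSet c))
  rw [Nat.card_eq_fintype_card, Fintype.card_equiv (Fintype.equivFinOfCardEq hfixed), hfixed,
    factorial_mul_natCard_isFixedWord] at hpairs
  have hsep := le_natCard_isSeparating (k := k) (movedPerm c)
    fun v h => v.2 (congrArg Subtype.val h)
  rw [hmoved] at hsep
  have hle : ((Fintype.card V - #(fixedSet c) : ℕ) : ℝ) ≤ Fintype.card V := by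
    exact_mod_cast Nat.sub_le _ _
  refine le_trans (mul_le_mul_of_nonneg_left (le_trans ?_ hsep) (Nat.cast_nonneg _))
    (by exact_mod_cast hpairs)
  gcongr

/-! ### The moment generating function as a negative binomial average -/

/-- The proportion of compatible pairs among the `N! * (k + N - 1).choose N` pairs of a total order
on the `N` points and a weakly monotone coloring with `k` colors. -/
noncomputable def compatibleRatio {V : Type*} [Fintype V] (e : Bool) (c : Equiv.Perm V) (k : ℕ)
    [NeZero k] : ℝ :=
  #(compatiblePairs e c k univ) / k.ascFactorial (Fintype.card V)

/-- The sign of an orientation. -/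
def orientSign (e : Bool) : ℝ := if e then 1 else -1

/-- The coefficient of `-N τ / x` in the logarithm of `compatibleRatio` with `k = N x / τ` colors,
when `N α` of the `N` points are fixed. -/
noncomputable def linearCoeff (e : Bool) (α : ℝ) : ℝ := (1 - orientSign e * α ^ 2) / 2

/-- The unnormalized negative binomial weight of `k + 1` colors for `N` points. -/
noncomputable def colorWeight (N : ℕ) (t : ℝ) (k : ℕ) : ℝ :=
  t ^ (k + 1) * ((k + N).choose N : ℝ)

instance permMeasurableSingletonClass (n : ℕ) : MeasurableSingletonClass (Equiv.Perm (Fin n)) :=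
  ⟨fun _ => trivial⟩

section conjClass

variable {n : ℕ} {lam : n.Partition} {c π σ : Equiv.Perm (Fin n)}

lemma mem_conjClass : π ∈ conjClass lam ↔ π.partition.parts = lam.parts := by
  simp [conjClass]

lemma classLaw_real_singleton (lam : n.Partition) (π : Equiv.Perm (Fin n)) :
    (classLaw lam).real {π} = if π ∈ conjClass lam then (#(conjClass lam) : ℝ)⁻¹ else 0 := by
  rw [MeasureTheory.Measure.real, classLaw, ← coe_singleton,
    ProbabilityTheory.uniformOn_apply_finset]
  split_ifs with hπ
  · simp [inter_singleton_of_mem hπ]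
  · simp [inter_singleton_of_notMem hπ]

lemma descentMGF_eq_sum (lam : n.Partition) (s : ℝ) :
    descentMGF lam s =
      (∑ π ∈ conjClass lam, Real.exp (s * normalizedDescent lam π)) / #(conjClass lam) := by
  have : MeasureTheory.IsFiniteMeasure (classLaw lam) := by unfold classLaw; infer_instance
  rw [descentMGF, ProbabilityTheory.mgf,
    MeasureTheory.integral_fintype MeasureTheory.Integrable.of_finite]
  simp only [classLaw_real_singleton, smul_eq_mul, ite_mul, zero_mul, sum_ite_mem, univ_inter]
  rw [← mul_sum, div_eq_inv_mul]

lemma parts_eq_filter_two_le_add_replicate (lam : n.Partition) :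
    lam.parts = lam.parts.filter (2 ≤ ·) +
      Multiset.replicate (n - (lam.parts.filter (2 ≤ ·)).sum) 1 := by
  have hsplit := Multiset.filter_add_not (2 ≤ ·) lam.parts
  have hones : lam.parts.filter (¬ 2 ≤ ·) =
      Multiset.replicate (lam.parts.filter (¬ 2 ≤ ·)).card 1 := by
    refine Multiset.eq_replicate_card.2 fun a ha => ?_
    obtain ⟨hmem, hlt⟩ := Multiset.mem_filter.1 ha
    have := lam.parts_pos hmem
    omega
  have hsum := congrArg Multiset.sum hsplit
  rw [hones, Multiset.sum_add, Multiset.sum_replicate, smul_eq_mul, mul_one, lam.parts_sum] at hsum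
  rw [show n - (lam.parts.filter (2 ≤ ·)).sum = (lam.parts.filter (¬ 2 ≤ ·)).card by omega, ← hones,
    hsplit]

lemma conjClass_nonempty (lam : n.Partition) : (conjClass lam).Nonempty := by
  have hparts := parts_eq_filter_two_le_add_replicate lam
  have hle : (lam.parts.filter (2 ≤ ·)).sum ≤ n := by
    have hsum := congrArg Multiset.sum (Multiset.filter_add_not (2 ≤ ·) lam.parts)
    rw [Multiset.sum_add, lam.parts_sum] at hsum
    omega
  obtain ⟨g, hg⟩ := (Equiv.Perm.exists_with_cycleType_iff (Fin n)).2
    ⟨hle.trans_eq (Fintype.card_fin n).symm, fun a ha => (Multiset.mem_filter.1 ha).2⟩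
  refine ⟨g, mem_conjClass.2 ?_⟩
  rw [Equiv.Perm.parts_partition, ← Equiv.Perm.sum_cycleType, hg, Fintype.card_fin, ← hparts]

lemma mem_conjClass_iff_isConj (hc : c ∈ conjClass lam) : π ∈ conjClass lam ↔ IsConj c π := by
  rw [Equiv.Perm.partition_eq_of_isConj, Nat.Partition.ext_iff, mem_conjClass.1 hc, mem_conjClass,
    eq_comm]

lemma conj_mem_conjClass : σ * π * σ⁻¹ ∈ conjClass lam ↔ π ∈ conjClass lam := by
  have hconj : IsConj π (σ * π * σ⁻¹) := isConj_iff.2 ⟨σ, rfl⟩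
  rw [mem_conjClass, mem_conjClass, Equiv.Perm.partition_eq_of_isConj.1 hconj]

lemma mult_one_eq_card_fixedSet (hc : c ∈ conjClass lam) : mult lam 1 = #(fixedSet c) := by
  have hone : 1 ∉ c.cycleType := fun h => (Equiv.Perm.one_lt_of_mem_cycleType h).false
  have hfixed : fixedSet c = c.supportᶜ := by ext v; simp
  rw [mult, ← mem_conjClass.1 hc, Equiv.Perm.parts_partition, Multiset.count_add,
    Multiset.count_replicate_self, Multiset.count_eq_zero_of_notMem hone, zero_add, hfixed,
    card_compl]

lemma sum_perm_conj_eq (hc : c ∈ conjClass lam) (hπ : π ∈ conjClass lam)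
    (g : Equiv.Perm (Fin n) → ℝ) :
    ∑ σ : Equiv.Perm (Fin n), g (σ * π * σ⁻¹) = ∑ σ : Equiv.Perm (Fin n), g (σ * c * σ⁻¹) := by
  obtain ⟨τ, rfl⟩ := isConj_iff.1 ((mem_conjClass_iff_isConj hc).1 hπ)
  refine Fintype.sum_equiv (Equiv.mulRight τ) _ _ fun σ => congrArg g ?_
  simp only [Equiv.coe_mulRight, mul_inv_rev, mul_assoc]

lemma sum_conjClass_conj (lam : n.Partition) (σ : Equiv.Perm (Fin n))
    (g : Equiv.Perm (Fin n) → ℝ) :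
    ∑ π ∈ conjClass lam, g (σ * π * σ⁻¹) = ∑ π ∈ conjClass lam, g π :=
  sum_equiv (MulAut.conj σ).toEquiv (fun _ => conj_mem_conjClass.symm) fun _ _ => rfl

lemma average_conjClass (hc : c ∈ conjClass lam) (g : Equiv.Perm (Fin n) → ℝ) :
    (∑ π ∈ conjClass lam, g π) / #(conjClass lam) =
      (∑ σ : Equiv.Perm (Fin n), g (σ * c * σ⁻¹)) / n.factorial := by
  have hdouble : (n.factorial : ℝ) * ∑ π ∈ conjClass lam, g π =
      #(conjClass lam) * ∑ σ : Equiv.Perm (Fin n), g (σ * c * σ⁻¹) := by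
    calc (n.factorial : ℝ) * ∑ π ∈ conjClass lam, g π
        = ∑ σ : Equiv.Perm (Fin n), ∑ π ∈ conjClass lam, g (σ * π * σ⁻¹) := by
          simp [sum_conjClass_conj, Fintype.card_perm]
      _ = ∑ π ∈ conjClass lam, ∑ σ : Equiv.Perm (Fin n), g (σ * π * σ⁻¹) := sum_comm
      _ = #(conjClass lam) * ∑ σ : Equiv.Perm (Fin n), g (σ * c * σ⁻¹) := by
          rw [sum_congr rfl fun π hπ => sum_perm_conj_eq hc hπ g, sum_const, nsmul_eq_mul]
  have hcard : (#(conjClass lam) : ℝ) ≠ 0 := by exact_mod_cast (card_pos.2 ⟨c, hc⟩).ne'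
  rw [div_eq_div_iff hcard (by exact_mod_cast n.factorial_ne_zero)]
  linarith

end conjClass

lemma orientSign_sq (e : Bool) : orientSign e ^ 2 = 1 := by cases e <;> simp [orientSign]

lemma colorWeight_nonneg (N : ℕ) {t : ℝ} (ht : 0 ≤ t) (k : ℕ) : 0 ≤ colorWeight N t k := by
  unfold colorWeight; positivity

lemma hasSum_colorWeight (N : ℕ) {t : ℝ} (ht0 : 0 ≤ t) (ht1 : t < 1) :
    HasSum (colorWeight N t) (t / (1 - t) ^ (N + 1)) := by
  have h := (hasSum_choose_mul_geometric_of_norm_lt_one (𝕜 := ℝ) N (r := t)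
    (by rwa [Real.norm_of_nonneg ht0])).mul_left t
  convert! h using 1
  · funext k
    rw [colorWeight, pow_succ']
    ring
  · ring

lemma hasSum_pow_mul_choose_add {n q : ℕ} (hq : q ≤ n) {t : ℝ} (ht0 : 0 ≤ t) (ht1 : t < 1) :
    HasSum (fun k : ℕ => t ^ (k + 1) * ((k + 1 + q).choose (n + 1) : ℝ))
      (t ^ (n + 1 - q) / (1 - t) ^ (n + 2)) := by
  rw [← hasSum_nat_add_iff' (n - q)]
  have hzero : ∑ i ∈ range (n - q), t ^ (i + 1) * ((i + 1 + q).choose (n + 1) : ℝ) = 0 := by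
    refine sum_eq_zero fun i hi => ?_
    rw [Nat.choose_eq_zero_of_lt (by have := mem_range.1 hi; omega), Nat.cast_zero, mul_zero]
  rw [hzero, sub_zero]
  convert! (hasSum_colorWeight (n + 1) ht0 ht1).mul_left (t ^ (n - q)) using 1
  · funext k
    rw [colorWeight, show k + (n - q) + 1 + q = k + (n + 1) by omega,
      show k + (n - q) + 1 = (n - q) + (k + 1) by omega, pow_add, mul_assoc]
  · rw [show n + 1 - q = n - q + 1 by omega, pow_succ, mul_div_assoc]

section ratio

variable {n : ℕ}

lemma compatibleRatio_nonneg {V : Type*} [Fintype V] (e : Bool) (c : Equiv.Perm V) (k : ℕ)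
    [NeZero k] : 0 ≤ compatibleRatio e c k := by
  unfold compatibleRatio; positivity

lemma weakSteps_le (e : Bool) (π : Equiv.Perm (Fin (n + 1))) : weakSteps e π ≤ n := by
  have := descentNumber_le π
  unfold weakSteps
  split_ifs <;> omega

lemma compatibleRatio_le_one (e : Bool) (c : Equiv.Perm (Fin (n + 1))) (k : ℕ) [NeZero k] :
    compatibleRatio e c k ≤ 1 := by
  refine div_le_one_of_le₀ (Nat.cast_le.2 ?_) (Nat.cast_nonneg _)
  rw [card_compatiblePairs_eq_sum_choose, Fintype.card_fin,
    Nat.ascFactorial_eq_factorial_mul_choose']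
  calc ∑ σ : Equiv.Perm (Fin (n + 1)), (k + weakSteps e (σ * c * σ⁻¹)).choose (n + 1)
      ≤ ∑ _σ : Equiv.Perm (Fin (n + 1)), (k + (n + 1) - 1).choose (n + 1) :=
        sum_le_sum fun σ _ => Nat.choose_le_choose _ <| by
          have := weakSteps_le e (σ * c * σ⁻¹)
          omega
    _ = (n + 1).factorial * (k + (n + 1) - 1).choose (n + 1) := by simp [Fintype.card_perm]

lemma colorWeight_mul_compatibleRatio (e : Bool) (c : Equiv.Perm (Fin (n + 1))) (t : ℝ) (k : ℕ) :
    colorWeight (n + 1) t k * compatibleRatio e c (k + 1) =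
      (∑ σ : Equiv.Perm (Fin (n + 1)),
        t ^ (k + 1) * ((k + 1 + weakSteps e (σ * c * σ⁻¹)).choose (n + 1) : ℝ)) /
          (n + 1).factorial := by
  have hchoose : ((k + (n + 1)).choose (n + 1) : ℝ) ≠ 0 := by
    exact_mod_cast (Nat.choose_pos (by omega)).ne'
  have hfactorial : ((n + 1).factorial : ℝ) ≠ 0 := by exact_mod_cast (n + 1).factorial_ne_zero
  rw [colorWeight, compatibleRatio, card_compatiblePairs_eq_sum_choose, Fintype.card_fin,
    Nat.ascFactorial_eq_factorial_mul_choose', ← mul_sum,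
    show k + 1 + (n + 1) - 1 = k + (n + 1) by omega]
  push_cast
  field_simp

lemma hasSum_colorWeight_mul_compatibleRatio (e : Bool) (c : Equiv.Perm (Fin (n + 1))) {t : ℝ}
    (ht0 : 0 ≤ t) (ht1 : t < 1) :
    HasSum (fun k => colorWeight (n + 1) t k * compatibleRatio e c (k + 1))
      ((∑ σ : Equiv.Perm (Fin (n + 1)), t ^ (n + 1 - weakSteps e (σ * c * σ⁻¹))) /
        (n + 1).factorial / (1 - t) ^ (n + 2)) := by
  simp only [colorWeight_mul_compatibleRatio]
  rw [div_right_comm, sum_div]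
  exact (hasSum_sum fun σ _ =>
    hasSum_pow_mul_choose_add (weakSteps_le e (σ * c * σ⁻¹)) ht0 ht1).div_const _

lemma cast_sub_weakSteps (e : Bool) (π : Equiv.Perm (Fin (n + 1))) :
    ((n + 1 - weakSteps e π : ℕ) : ℝ) =
      (n + 1) / 2 + 1 / 2 + orientSign e * (descentNumber π - n / 2) := by
  have hdescent := descentNumber_le π
  cases e with
  | true =>
    rw [weakSteps, if_pos rfl, show n + 1 - (n - descentNumber π) = descentNumber π + 1 by omega]
    simp only [orientSign, if_true]
    push_cast
    ring
  | false =>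
    rw [weakSteps, if_neg Bool.false_ne_true, Nat.cast_sub (by omega)]
    simp only [orientSign, Bool.false_eq_true, if_false]
    push_cast
    ring

lemma normalizedDescent_exponent_eq (e : Bool) (lam : (n + 1).Partition)
    (π : Equiv.Perm (Fin (n + 1))) (τ : ℝ) :
    -(orientSign e * (τ * √(n + 1 : ℕ))) * normalizedDescent lam π =
      orientSign e * τ + (τ / 2 + (n + 1 : ℕ) * τ * linearCoeff e (fixedRatio lam) +
        (n + 1 - weakSteps e π : ℕ) * -τ) := by
  have hsqrt : √((n + 1 : ℕ) : ℝ) ≠ 0 := (Real.sqrt_pos.2 (by positivity)).ne'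
  rw [cast_sub_weakSteps, normalizedDescent, linearCoeff, fixedRatio]
  field_simp
  push_cast
  ring

theorem descentMGF_eq_tsum {lam : (n + 1).Partition} {c : Equiv.Perm (Fin (n + 1))}
    (hc : c ∈ conjClass lam) (e : Bool) {τ : ℝ} (hτ : 0 < τ) :
    descentMGF lam (-(orientSign e * (τ * √(n + 1 : ℕ)))) =
      Real.exp (orientSign e * τ) *
        (Real.exp (τ / 2 + (n + 1 : ℕ) * τ * linearCoeff e (fixedRatio lam)) *
          ((1 - Real.exp (-τ)) ^ (n + 2) *
            ∑' k, colorWeight (n + 1) (Real.exp (-τ)) k * compatibleRatio e c (k + 1))) := by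
  have ht1 : Real.exp (-τ) < 1 := Real.exp_lt_one_iff.2 (neg_lt_zero.2 hτ)
  rw [(hasSum_colorWeight_mul_compatibleRatio e c (Real.exp_pos _).le ht1).tsum_eq,
    mul_div_cancel₀ _ (pow_pos (sub_pos.2 ht1) _).ne', descentMGF_eq_sum, average_conjClass hc,
    ← mul_div_assoc, ← mul_div_assoc, mul_sum, mul_sum]
  simp only [normalizedDescent_exponent_eq, Real.exp_add, ← Real.exp_nat_mul]

end ratio

/-! ### The proportion of compatible pairs -/

/-- The coefficient of `N τ ^ 2 / (2 x ^ 2)` in the logarithm of `compatibleRatio` with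
`k = N x / τ` colors, when `N α` of the `N` points are fixed. -/
noncomputable def quadraticCoeff (α : ℝ) : ℝ := (1 - α ^ 3) / 3

/-- The leading part of the logarithm of `compatibleRatio` with `k = N x / τ` colors. -/
noncomputable def rate (N τ p r x : ℝ) : ℝ := -(N * τ * p / x) + N * τ ^ 2 * r / (2 * x ^ 2)

/-- The logarithm of `orientedFactorial e k m / k ^ m`, where `u = 1 / k`. -/
noncomputable def logProduct (e : Bool) (u : ℝ) (m : ℕ) : ℝ :=
  ∑ j ∈ range m, Real.log (1 + orientSign e * j * u)

lemma abs_log_one_add_sub_le {x : ℝ} (hx : |x| ≤ 1 / 2) :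
    |Real.log (1 + x) - (x - x ^ 2 / 2)| ≤ 2 * |x| ^ 3 := by
  have htaylor := Real.abs_log_sub_add_sum_range_le (x := -x) (by rw [abs_neg]; linarith) 2
  have hsum : (∑ i ∈ range 2, (-x) ^ (i + 1) / ((i : ℝ) + 1)) + Real.log (1 - -x) =
      Real.log (1 + x) - (x - x ^ 2 / 2) := by
    rw [sum_range_succ, sum_range_one, sub_neg_eq_add]
    norm_num
    ring
  rw [hsum, abs_neg] at htaylor
  refine htaylor.trans ?_
  rw [div_le_iff₀ (by linarith)]
  norm_num
  nlinarith [pow_nonneg (abs_nonneg x) 3]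

lemma abs_orientSign (e : Bool) : |orientSign e| = 1 := by cases e <;> simp [orientSign]

lemma sum_range_taylor_eq (ε u : ℝ) (m : ℕ) :
    ∑ j ∈ range m, (ε * j * u - (j * u) ^ 2 / 2) =
      (ε * m ^ 2 * u / 2 - m ^ 3 * u ^ 2 / 6) - ε * (m * u) / 2 + (m * u) ^ 2 / 4 -
        m * u ^ 2 / 12 := by
  induction m with
  | zero => simp
  | succ m ih =>
    rw [sum_range_succ, ih]
    push_cast
    ring

lemma abs_logProduct_sub_sum_le (e : Bool) {u : ℝ} (hu : 0 ≤ u) {m : ℕ} (hm : m * u ≤ 1 / 2) :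
    |logProduct e u m - ∑ j ∈ range m, (orientSign e * j * u - (j * u) ^ 2 / 2)| ≤
      2 * m * (m * u) ^ 3 := by
  have hterm (j : ℕ) (hj : j ∈ range m) :
      |Real.log (1 + orientSign e * j * u) - (orientSign e * j * u - (j * u) ^ 2 / 2)| ≤
        2 * (m * u) ^ 3 := by
    have hju : (j : ℝ) * u ≤ m * u := by gcongr; exact (mem_range.1 hj).le
    have habs : |orientSign e * j * u| = j * u := by
      rw [abs_mul, abs_mul, abs_orientSign, abs_of_nonneg hu, Nat.abs_cast, one_mul]
    have hlog := abs_log_one_add_sub_le (x := orientSign e * j * u) (by rw [habs]; linarith)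
    rw [← sq_abs (orientSign e * j * u), habs] at hlog
    exact hlog.trans (by gcongr)
  rw [logProduct, ← sum_sub_distrib]
  calc |∑ j ∈ range m, (Real.log (1 + orientSign e * j * u) -
        (orientSign e * j * u - (j * u) ^ 2 / 2))|
      ≤ ∑ j ∈ range m, 2 * (m * u) ^ 3 := (abs_sum_le_sum_abs _ _).trans (sum_le_sum hterm)
    _ = 2 * m * (m * u) ^ 3 := by rw [sum_const, card_range, nsmul_eq_mul]; ring

lemma abs_logProduct_sub_le (e : Bool) {u : ℝ} (hu : 0 ≤ u) {m : ℕ} (hm : m * u ≤ 1 / 2) :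
    |logProduct e u m - (orientSign e * m ^ 2 * u / 2 - m ^ 3 * u ^ 2 / 6)| ≤
      m * u / 2 + (m * u) ^ 2 + 2 * m * (m * u) ^ 3 := by
  have hsum := abs_logProduct_sub_sum_le e hu hm
  rw [sum_range_taylor_eq] at hsum
  have hlinear : |orientSign e * (m * u) / 2| ≤ m * u / 2 := by
    rw [abs_div, abs_mul, abs_orientSign, one_mul, abs_of_nonneg (by positivity), abs_two]
  have hquadratic : (m : ℝ) * u ^ 2 ≤ (m * u) ^ 2 := by
    rw [mul_pow]
    exact mul_le_mul_of_nonneg_right (by exact_mod_cast Nat.le_self_pow two_ne_zero m)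
      (by positivity)
  have hquadratic0 : 0 ≤ (m : ℝ) * u ^ 2 := by positivity
  rw [abs_le] at hsum hlinear ⊢
  constructor <;> linarith [hsum.1, hsum.2, hlinear.1, hlinear.2]

lemma cast_orientedFactorial_succ (e : Bool) {k m : ℕ} (hmk : m ≤ k) :
    (orientedFactorial e k (m + 1) : ℝ) =
      orientedFactorial e k m * (k + orientSign e * m) := by
  cases e with
  | true =>
    simp only [orientedFactorial, orientSign, if_true, Nat.ascFactorial_succ]
    push_cast
    ring
  | false =>
    simp only [orientedFactorial, orientSign, Bool.false_eq_true, if_false,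
      Nat.descFactorial_succ]
    push_cast [hmk]
    ring

lemma cast_orientedFactorial_eq (e : Bool) {k m : ℕ} (hmk : m ≤ k) :
    (orientedFactorial e k m : ℝ) = (k : ℝ) ^ m * Real.exp (logProduct e (k : ℝ)⁻¹ m) := by
  induction m with
  | zero => cases e <;> simp [orientedFactorial, logProduct]
  | succ m ih =>
    have hk : (0 : ℝ) < k := by exact_mod_cast (Nat.succ_pos m).trans_le hmk
    have hm : (m : ℝ) * (k : ℝ)⁻¹ < 1 := by
      rw [← div_eq_mul_inv, div_lt_one hk]
      exact_mod_cast hmk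
    have habs := neg_abs_le (orientSign e * m * (k : ℝ)⁻¹)
    rw [abs_mul, abs_mul, abs_orientSign, one_mul, Nat.abs_cast, abs_of_pos (inv_pos.2 hk)] at habs
    rw [cast_orientedFactorial_succ e (by omega), ih (by omega), logProduct, logProduct,
      sum_range_succ, Real.exp_add, Real.exp_log (by linarith), pow_succ]
    field_simp

lemma leading_ratio_eq_exp (e : Bool) {N m k : ℕ} (hk : 0 < k) (hmN : m ≤ N) (hNk : N ≤ k) :
    (orientedFactorial e k m : ℝ) * (k : ℝ) ^ (N - m) / k.ascFactorial N =
      Real.exp (logProduct e (k : ℝ)⁻¹ m - logProduct true (k : ℝ)⁻¹ N) := by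
  have hk' : (0 : ℝ) < k := by exact_mod_cast hk
  have hasc : (k.ascFactorial N : ℝ) = _ := cast_orientedFactorial_eq true hNk
  rw [hasc, cast_orientedFactorial_eq e (hmN.trans hNk), mul_right_comm, ← pow_add,
    Nat.add_sub_cancel' hmN, Real.exp_sub, mul_div_mul_left _ _ (pow_pos hk' N).ne']

lemma rate_eq_logProduct_main (e : Bool) {N m k τ : ℝ} (hN : N ≠ 0) (hk : k ≠ 0) (hτ : τ ≠ 0) :
    rate N τ (linearCoeff e (m / N)) (quadraticCoeff (m / N)) (k * τ / N) =
      (orientSign e * m ^ 2 * k⁻¹ / 2 - m ^ 3 * k⁻¹ ^ 2 / 6) -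
        (orientSign true * N ^ 2 * k⁻¹ / 2 - N ^ 3 * k⁻¹ ^ 2 / 6) := by
  rw [rate, linearCoeff, quadraticCoeff, orientSign, orientSign, if_pos rfl]
  field_simp
  ring

section ratioBounds

variable {τ : ℝ}

lemma abs_logProduct_sub_logProduct_sub_rate_le (e : Bool) {N m k : ℕ} (hN : 0 < N) (hk : 0 < k)
    (hmN : m ≤ N) (hτ : 0 < τ) (hτ1 : τ ≤ 1 / 16) (hNk : (N : ℝ) / k ≤ 2 * τ) :
    |logProduct e (k : ℝ)⁻¹ m - logProduct true (k : ℝ)⁻¹ N -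
      rate N τ (linearCoeff e (m / N)) (quadraticCoeff (m / N)) (k * τ / N)| ≤
        (3 + 32 * (N * τ ^ 2)) * τ := by
  have hN' : (0 : ℝ) < N := by exact_mod_cast hN
  have hk' : (0 : ℝ) < k := by exact_mod_cast hk
  rw [rate_eq_logProduct_main e hN'.ne' hk'.ne' hτ.ne']
  rw [div_eq_mul_inv] at hNk
  have hmk : (m : ℝ) * (k : ℝ)⁻¹ ≤ 2 * τ := le_trans (by gcongr) hNk
  have herr {i : ℕ} (hi : i ≤ N) (hik : (i : ℝ) * (k : ℝ)⁻¹ ≤ 2 * τ) :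
      i * (k : ℝ)⁻¹ / 2 + (i * (k : ℝ)⁻¹) ^ 2 + 2 * i * (i * (k : ℝ)⁻¹) ^ 3 ≤
        τ + 4 * τ ^ 2 + 16 * (N * τ ^ 2) * τ := by
    calc i * (k : ℝ)⁻¹ / 2 + (i * (k : ℝ)⁻¹) ^ 2 + 2 * i * (i * (k : ℝ)⁻¹) ^ 3
        ≤ 2 * τ / 2 + (2 * τ) ^ 2 + 2 * N * (2 * τ) ^ 3 := by gcongr
      _ = τ + 4 * τ ^ 2 + 16 * (N * τ ^ 2) * τ := by ring
  have hm := (abs_logProduct_sub_le e (inv_nonneg.2 hk'.le) (hmk.trans (by linarith))).trans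
    (herr hmN hmk)
  have hall := (abs_logProduct_sub_le true (inv_nonneg.2 hk'.le) (hNk.trans (by linarith))).trans
    (herr le_rfl hNk)
  have hsq : τ ^ 2 ≤ 1 / 16 * τ := by rw [sq]; gcongr
  rw [abs_le] at hm hall ⊢
  constructor <;> linarith [hm.1, hm.2, hall.1, hall.2]

lemma exp_neg_two_mul_le {y : ℝ} (h0 : 0 ≤ y) (h1 : y ≤ 1 / 2) : Real.exp (-(2 * y)) ≤ 1 - y := by
  rw [Real.exp_neg, inv_le_comm₀ (Real.exp_pos _) (by linarith)]
  refine le_trans ?_ (Real.add_one_le_exp (2 * y))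
  rw [inv_le_iff_one_le_mul₀ (by linarith)]
  nlinarith

variable {V : Type*} [Fintype V] [DecidableEq V] {k : ℕ} [NeZero k]

lemma le_compatibleRatio_of_card_div_le (e : Bool) (c : Equiv.Perm V) (hτ : 0 < τ)
    (hτ1 : τ ≤ 1 / 16) (hNk : (Fintype.card V : ℝ) / k ≤ 2 * τ) :
    orientedFactorial e k #(fixedSet c) * (k : ℝ) ^ (Fintype.card V - #(fixedSet c)) /
      k.ascFactorial (Fintype.card V) * Real.exp (-(6 * τ)) ≤ compatibleRatio e c k := by
  have hsq : τ ^ 2 ≤ 1 / 16 * τ := by rw [sq]; gcongr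
  have hNk2 : (Fintype.card V : ℝ) ^ 2 / k ^ 2 ≤ (2 * τ) ^ 2 := by rw [← div_pow]; gcongr
  have hfactor : Real.exp (-(6 * τ)) ≤
      1 - Fintype.card V / k - (Fintype.card V : ℝ) ^ 2 / k ^ 2 := by
    have hexp := exp_neg_two_mul_le (y := 3 * τ) (by positivity) (by linarith)
    rw [← mul_assoc, show (2 : ℝ) * 3 = 6 by norm_num] at hexp
    linarith
  rw [div_mul_eq_mul_div, mul_assoc]
  refine div_le_div_of_nonneg_right (le_trans ?_ (le_card_compatiblePairs_univ (c := c)))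
    (Nat.cast_nonneg _)
  gcongr

lemma compatibleRatio_le_of_card_div_le (e : Bool) (c : Equiv.Perm V) (hτ : 0 < τ)
    (hτ1 : τ ≤ 1 / 16) (hNk : (Fintype.card V : ℝ) / k ≤ 2 * τ) :
    compatibleRatio e c k ≤
      orientedFactorial e k #(fixedSet c) * (k : ℝ) ^ (Fintype.card V - #(fixedSet c)) /
        k.ascFactorial (Fintype.card V) * Real.exp (6 * τ) := by
  have hsq : τ ^ 2 ≤ 1 / 16 * τ := by rw [sq]; gcongr
  have hNk2 : (Fintype.card V : ℝ) ^ 2 / k ^ 2 ≤ (2 * τ) ^ 2 := by rw [← div_pow]; gcongr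
  have hexponent : ((Fintype.card V - #(fixedSet c) : ℕ) : ℝ) *
      (1 / k + 2 * Fintype.card V / k ^ 2) ≤ 6 * τ := by
    calc ((Fintype.card V - #(fixedSet c) : ℕ) : ℝ) * (1 / k + 2 * Fintype.card V / k ^ 2)
        ≤ (Fintype.card V : ℝ) * (1 / k + 2 * Fintype.card V / k ^ 2) := by
          gcongr
          exact Nat.sub_le _ _
      _ = Fintype.card V / k + 2 * ((Fintype.card V : ℝ) ^ 2 / k ^ 2) := by ring
      _ ≤ 6 * τ := by linarith
  have hcount := card_compatiblePairs_univ_le (e := e) (k := k) (c := c)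
  rw [mul_pow, ← Real.exp_nat_mul] at hcount
  rw [div_mul_eq_mul_div, mul_assoc]
  refine div_le_div_of_nonneg_right (hcount.trans ?_) (Nat.cast_nonneg _)
  gcongr

theorem compatibleRatio_bounds (e : Bool) (c : Equiv.Perm V) {N α : ℝ} (hN : N = Fintype.card V)
    (hα : α = #(fixedSet c) / N) (hτ : 0 < τ) (hτ1 : τ ≤ 1 / 16) (hx : 1 / 2 ≤ k * τ / N) :
    Real.exp (rate N τ (linearCoeff e α) (quadraticCoeff α) (k * τ / N)
        - (9 + 32 * (N * τ ^ 2)) * τ) ≤ compatibleRatio e c k ∧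
      compatibleRatio e c k ≤ Real.exp (rate N τ (linearCoeff e α) (quadraticCoeff α) (k * τ / N)
        + (9 + 32 * (N * τ ^ 2)) * τ) := by
  have hk : (0 : ℝ) < k := by exact_mod_cast NeZero.pos k
  have hNpos : 0 < N := by
    by_contra! hneg
    linarith [div_nonpos_of_nonneg_of_nonpos (by positivity : 0 ≤ k * τ) hneg]
  have hNk : N / k ≤ 2 * τ := by
    rw [le_div_iff₀ hNpos] at hx
    rw [div_le_iff₀ hk]
    linarith
  have hcard : Fintype.card V ≤ k := by
    rw [div_le_iff₀ hk] at hNk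
    have : N ≤ k := hNk.trans (mul_le_of_le_one_left hk.le (by linarith))
    exact_mod_cast hN ▸ this
  subst hN hα
  have hcard0 : 0 < Fintype.card V := by exact_mod_cast hNpos
  have hlow := le_compatibleRatio_of_card_div_le e c hτ hτ1 hNk
  have hup := compatibleRatio_le_of_card_div_le e c hτ hτ1 hNk
  rw [leading_ratio_eq_exp e (NeZero.pos k) (card_le_univ _) hcard, ← Real.exp_add] at hlow hup
  have hdiff := abs_le.1 (abs_logProduct_sub_logProduct_sub_rate_le e hcard0 (NeZero.pos k)
    (card_le_univ (fixedSet c)) hτ hτ1 hNk)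
  exact ⟨(Real.exp_le_exp.2 (by linarith [hdiff.1])).trans hlow,
    hup.trans (Real.exp_le_exp.2 (by linarith [hdiff.2]))⟩

end ratioBounds

/-! ### Moments of the negative binomial weights -/

lemma colorWeight_mul_add (N k : ℕ) (t : ℝ) :
    colorWeight N t k * (k + 1 + N) = (N + 1) * colorWeight (N + 1) t k := by
  have hchoose : ((k : ℝ) + N + 1) * (k + N).choose N = (k + N + 1).choose (N + 1) * (N + 1) := by
    exact_mod_cast Nat.add_one_mul_choose_eq (k + N) N
  rw [colorWeight, colorWeight, ← add_assoc]
  linear_combination t ^ (k + 1) * hchoose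

lemma hasSum_colorWeight_mul_sq (N : ℕ) {t : ℝ} (ht0 : 0 ≤ t) (ht1 : t < 1) (κ : ℝ) :
    HasSum (fun k : ℕ => colorWeight N t k * (k + 1 - κ) ^ 2)
      (t / (1 - t) ^ (N + 1) *
        (((N + 1) / (1 - t) - (N + κ)) ^ 2 + (N + 1) / (1 - t) ^ 2 - (N + 1) / (1 - t))) := by
  have hmass := (hasSum_colorWeight N ht0 ht1).mul_left ((N + κ) ^ 2)
  have hfirst := (hasSum_colorWeight (N + 1) ht0 ht1).mul_left (-(2 * (N + κ) + 1) * (N + 1))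
  have hsecond := (hasSum_colorWeight (N + 2) ht0 ht1).mul_left (((N : ℝ) + 2) * (N + 1))
  convert! (hsecond.add hfirst).add hmass using 1
  · funext k
    have hstep := colorWeight_mul_add (N + 1) k t
    push_cast at hstep
    linear_combination (k + 1 - N - 2 * κ) * colorWeight_mul_add N k t + (N + 1) * hstep
  · have hne : 1 - t ≠ 0 := (sub_pos.2 ht1).ne'
    field_simp
    ring

lemma mul_one_sub_half_le_one_sub_exp_neg {x : ℝ} (hx : 0 ≤ x) :
    x * (1 - x / 2) ≤ 1 - Real.exp (-x) := by
  have hquad := Real.quadratic_le_exp_of_nonneg hx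
  have hinv : (Real.exp x)⁻¹ ≤ 1 - x * (1 - x / 2) := by
    rw [inv_le_iff_one_le_mul₀ (Real.exp_pos x)]
    have hnonneg : 0 ≤ 1 - x * (1 - x / 2) := by nlinarith [sq_nonneg (x - 1)]
    nlinarith [mul_le_mul_of_nonneg_left hquad hnonneg, sq_nonneg (x ^ 2)]
  rw [Real.exp_neg]
  linarith

lemma one_sub_exp_neg_pos {x : ℝ} (hx : 0 < x) : 0 < 1 - Real.exp (-x) :=
  sub_pos.2 (Real.exp_lt_one_iff.2 (neg_lt_zero.2 hx))

lemma one_le_div_one_sub_exp_neg {τ θ : ℝ} (hθ : 0 < θ) (hθτ : θ ≤ τ) :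
    1 ≤ τ / (1 - Real.exp (-θ)) := by
  rw [one_le_div (one_sub_exp_neg_pos hθ)]
  linarith [Real.one_sub_le_exp_neg θ]

lemma div_one_sub_exp_neg_le {τ θ : ℝ} (hτ : 0 < τ) (hτ1 : τ ≤ 1 / 16) (hlow : τ * (1 - τ) ≤ θ)
    (hθτ : θ ≤ τ) : τ / (1 - Real.exp (-θ)) ≤ 1 + 4 * τ := by
  have hθ : 0 < θ := (mul_pos hτ (by linarith)).trans_le hlow
  rw [div_le_iff₀ (one_sub_exp_neg_pos hθ)]
  calc τ ≤ (1 + 4 * τ) * (τ * (1 - τ) * (1 - τ / 2)) := by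
        have hone : 1 ≤ (1 + 4 * τ) * ((1 - τ) * (1 - τ / 2)) := by nlinarith [sq_nonneg τ]
        nlinarith
    _ ≤ (1 + 4 * τ) * (θ * (1 - θ / 2)) := by gcongr; linarith
    _ ≤ (1 + 4 * τ) * (1 - Real.exp (-θ)) := by
        gcongr
        exact mul_one_sub_half_le_one_sub_exp_neg hθ.le

lemma second_moment_polynomial_le {τ y u : ℝ} (hτ : 0 < τ) (hτ1 : τ ≤ 1 / 16) (hu : 0 ≤ u)
    (hu1 : u ≤ 1) (hy1 : 1 ≤ y) (hy : y ≤ 1 + 4 * τ) :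
    (y * (1 + u) - τ - 1) ^ 2 + y ^ 2 * u * (1 + u) - y * τ * u * (1 + u) ≤
      18 * τ ^ 2 + 12 * u := by
  have hmean : (y * (1 + u) - τ - 1) ^ 2 ≤ (3 * τ + 2 * u) ^ 2 :=
    sq_le_sq' (by nlinarith) (by nlinarith)
  have hmean' : (3 * τ + 2 * u) ^ 2 ≤ 18 * τ ^ 2 + 8 * u := by
    nlinarith [sq_nonneg (3 * τ - 2 * u)]
  have hvariance : y ^ 2 * u * (1 + u) ≤ 4 * u := by
    calc y ^ 2 * u * (1 + u) ≤ (5 / 4) ^ 2 * u * (1 + 1) := by gcongr; linarith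
      _ ≤ 4 * u := by linarith
  have hdrop : 0 ≤ y * τ * u * (1 + u) := by positivity
  linarith

lemma relative_second_moment_le {N τ θ : ℝ} (hN : 1 ≤ N) (hτ : 0 < τ) (hτ1 : τ ≤ 1 / 16)
    (hlow : τ * (1 - τ) ≤ θ) (hθτ : θ ≤ τ) :
    (((N + 1) / (1 - Real.exp (-θ)) - (N + N / τ)) ^ 2 + (N + 1) / (1 - Real.exp (-θ)) ^ 2 -
      (N + 1) / (1 - Real.exp (-θ))) / (N / τ) ^ 2 ≤ 18 * τ ^ 2 + 12 / N := by
  have hθ : 0 < θ := (mul_pos hτ (by linarith)).trans_le hlow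
  have hpoly := second_moment_polynomial_le hτ hτ1 (u := 1 / N) (by positivity)
    (div_le_one_of_le₀ hN (by linarith)) (one_le_div_one_sub_exp_neg hθ hθτ)
    (div_one_sub_exp_neg_le hτ hτ1 hlow hθτ)
  have hv := (one_sub_exp_neg_pos hθ).ne'
  generalize 1 - Real.exp (-θ) = v at hpoly hv ⊢
  rw [← mul_one_div 12]
  refine le_trans (le_of_eq ?_) hpoly
  field_simp
  ring

/-! ### Exponential tilting -/

/-- The range of step sizes and coefficients for which `rate N τ p r` lies below its tangent line
at `x = 1` on `[1 / 2, ∞)`. -/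
structure IsAdmissible (τ p r : ℝ) : Prop where
  pos : 0 < τ
  le_sixteenth : τ ≤ 1 / 16
  quadratic_nonneg : 0 ≤ r
  quadratic_le_linear : r ≤ p
  linear_le_one : p ≤ 1

/-- `N * slope τ p r` is the derivative of `rate N τ p r` at `x = 1`. -/
noncomputable def slope (τ p r : ℝ) : ℝ := τ * p - τ ^ 2 * r

/-- The parameter `θ` for which tilting the weights `colorWeight N (exp (-τ))` by the tangent to
`rate N τ p r` at `x = 1` gives a multiple of `colorWeight N (exp (-θ))`. -/
noncomputable def tiltedStep (τ p r : ℝ) : ℝ := τ * (1 - slope τ p r)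

/-- The total mass of `colorWeight N (exp (-τ))` weighted by the exponential of the tangent to
`rate N τ p r` at `x = 1`. -/
noncomputable def tiltedMass (N : ℕ) (τ p r : ℝ) : ℝ :=
  Real.exp (rate N τ p r 1 - N * slope τ p r) *
    (Real.exp (-tiltedStep τ p r) / (1 - Real.exp (-tiltedStep τ p r)) ^ (N + 1))

section tilt

variable {N : ℕ} {τ p r : ℝ}

lemma IsAdmissible.linear_nonneg (h : IsAdmissible τ p r) : 0 ≤ p :=
  h.quadratic_nonneg.trans h.quadratic_le_linear

lemma IsAdmissible.sq_le (h : IsAdmissible τ p r) : τ ^ 2 ≤ 1 / 16 * τ := by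
  rw [sq]
  exact mul_le_mul_of_nonneg_right h.le_sixteenth h.pos.le

lemma IsAdmissible.slope_nonneg (h : IsAdmissible τ p r) : 0 ≤ slope τ p r := by
  have hpos := h.pos
  have hp := h.linear_nonneg
  have hle : τ ^ 2 * r ≤ 1 / 16 * τ * p :=
    mul_le_mul h.sq_le h.quadratic_le_linear h.quadratic_nonneg (by positivity)
  have : 0 ≤ τ * p := by positivity
  unfold slope
  linarith

lemma IsAdmissible.slope_le (h : IsAdmissible τ p r) : slope τ p r ≤ τ := by
  have hlinear : τ * p ≤ τ := mul_le_of_le_one_right h.pos.le h.linear_le_one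
  have hquadratic : 0 ≤ τ ^ 2 * r := mul_nonneg (sq_nonneg τ) h.quadratic_nonneg
  unfold slope
  linarith

lemma IsAdmissible.tiltedStep_le (h : IsAdmissible τ p r) : tiltedStep τ p r ≤ τ :=
  mul_le_of_le_one_right h.pos.le (by linarith [h.slope_nonneg])

lemma IsAdmissible.mul_one_sub_le_tiltedStep (h : IsAdmissible τ p r) :
    τ * (1 - τ) ≤ tiltedStep τ p r :=
  mul_le_mul_of_nonneg_left (by linarith [h.slope_le]) h.pos.le

lemma IsAdmissible.tiltedStep_pos (h : IsAdmissible τ p r) : 0 < tiltedStep τ p r :=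
  mul_pos h.pos (by linarith [h.slope_le, h.le_sixteenth])

lemma rate_eq_tangent_sub (N τ p r : ℝ) {x : ℝ} (hx : x ≠ 0) :
    rate N τ p r x = rate N τ p r 1 + N * slope τ p r * (x - 1) -
      N * τ * (x - 1) ^ 2 / x ^ 2 * (p * x - τ * r * (1 + 2 * x) / 2) := by
  unfold rate slope
  field_simp
  ring

lemma IsAdmissible.rate_le_tangent (h : IsAdmissible τ p r) {N x : ℝ} (hN : 0 ≤ N)
    (hx : 1 / 2 ≤ x) : rate N τ p r x ≤ rate N τ p r 1 + N * slope τ p r * (x - 1) := by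
  have hτ := h.pos
  have hr := h.quadratic_nonneg
  rw [rate_eq_tangent_sub _ _ _ _ (by linarith)]
  refine sub_le_self _ (mul_nonneg (by positivity) ?_)
  have hwiden : τ * r * (1 + 2 * x) / 2 ≤ τ * r * (4 * x) / 2 := by gcongr; linarith
  have hsmall : τ * r ≤ 1 / 16 * p :=
    mul_le_mul h.le_sixteenth h.quadratic_le_linear hr (by norm_num)
  nlinarith [h.linear_nonneg]

lemma IsAdmissible.tangent_sub_le_rate (h : IsAdmissible τ p r) {N x : ℝ} (hN : 0 ≤ N)
    (hx : 1 / 2 ≤ x) :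
    rate N τ p r 1 + N * slope τ p r * (x - 1) - 2 * N * τ * (x - 1) ^ 2 ≤ rate N τ p r x := by
  have hτ := h.pos
  have hr := h.quadratic_nonneg
  have hx0 : 0 < x := by linarith
  rw [rate_eq_tangent_sub _ _ _ _ hx0.ne']
  refine sub_le_sub_left ?_ _
  have hfactor : p * x - τ * r * (1 + 2 * x) / 2 ≤ x := by
    have : 0 ≤ τ * r * (1 + 2 * x) / 2 := by positivity
    nlinarith [h.linear_le_one]
  calc N * τ * (x - 1) ^ 2 / x ^ 2 * (p * x - τ * r * (1 + 2 * x) / 2)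
      ≤ N * τ * (x - 1) ^ 2 / x ^ 2 * x := by gcongr
    _ = 1 / x * (N * τ * (x - 1) ^ 2) := by field_simp
    _ ≤ 2 * (N * τ * (x - 1) ^ 2) := by
        gcongr
        rw [div_le_iff₀ hx0]
        linarith
    _ = 2 * N * τ * (x - 1) ^ 2 := by ring

lemma colorWeight_mul_exp (N k : ℕ) (a b : ℝ) :
    colorWeight N (Real.exp (-a)) k * Real.exp ((k + 1) * b) =
      colorWeight N (Real.exp (-(a - b))) k := by
  have hcast : (k + 1 : ℝ) = (k + 1 : ℕ) := by push_cast; rfl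
  rw [hcast, Real.exp_nat_mul, colorWeight, colorWeight, mul_right_comm, ← mul_pow, ← Real.exp_add,
    neg_sub', sub_neg_eq_add]

lemma colorWeight_mul_exp_slope (hN : N ≠ 0) (τ p r : ℝ) (k : ℕ) :
    colorWeight N (Real.exp (-τ)) k * Real.exp (N * slope τ p r * ((k + 1) * τ / N)) =
      colorWeight N (Real.exp (-tiltedStep τ p r)) k := by
  have hN' : (N : ℝ) ≠ 0 := Nat.cast_ne_zero.2 hN
  rw [show N * slope τ p r * ((k + 1) * τ / N) = (k + 1) * (τ * slope τ p r) by field_simp,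
    colorWeight_mul_exp, tiltedStep, mul_sub, mul_one]

/-- A sequence in `[0, 1]` that is within a factor `exp (± C * τ)` of `exp (rate N τ p r x)` at
the index `k` with `x = (k + 1) * τ / N`, as soon as `1 / 2 ≤ x`. -/
structure IsNearRate (N : ℕ) (τ p r C : ℝ) (ρ : ℕ → ℝ) : Prop where
  nonneg (k : ℕ) : 0 ≤ ρ k
  le_one (k : ℕ) : ρ k ≤ 1
  lower {k : ℕ} : 1 / 2 ≤ (k + 1) * τ / N →
    Real.exp (rate N τ p r ((k + 1) * τ / N) - C * τ) ≤ ρ k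
  upper {k : ℕ} : 1 / 2 ≤ (k + 1) * τ / N →
    ρ k ≤ Real.exp (rate N τ p r ((k + 1) * τ / N) + C * τ)

namespace IsNearRate

variable {C : ℝ} {ρ : ℕ → ℝ}

lemma le_exp_tangent (hρ : IsNearRate N τ p r C ρ) (h : IsAdmissible τ p r) {k : ℕ}
    (hx : 1 / 2 ≤ (k + 1) * τ / N) :
    ρ k ≤ Real.exp (C * τ) * Real.exp (rate N τ p r 1 - N * slope τ p r) *
      Real.exp (N * slope τ p r * ((k + 1) * τ / N)) := by
  refine (hρ.upper hx).trans ?_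
  rw [← Real.exp_add, ← Real.exp_add, Real.exp_le_exp]
  linarith [h.rate_le_tangent N.cast_nonneg hx]

lemma exp_tangent_mul_le (hρ : IsNearRate N τ p r C ρ) (h : IsAdmissible τ p r) {k : ℕ}
    (hx : 1 / 2 ≤ (k + 1) * τ / N) :
    Real.exp (-(C * τ)) * Real.exp (rate N τ p r 1 - N * slope τ p r) *
      Real.exp (N * slope τ p r * ((k + 1) * τ / N)) *
        (1 - (2 * N * τ + 4) * ((k + 1) * τ / N - 1) ^ 2) ≤ ρ k := by
  refine le_trans ?_ (hρ.lower hx)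
  have htangent := h.tangent_sub_le_rate N.cast_nonneg hx
  generalize (k + 1) * τ / N = x at htangent ⊢
  have hexp := Real.add_one_le_exp (-(2 * N * τ * (x - 1) ^ 2))
  calc _ ≤ Real.exp (-(C * τ)) * Real.exp (rate N τ p r 1 - N * slope τ p r) *
        Real.exp (N * slope τ p r * x) * Real.exp (-(2 * N * τ * (x - 1) ^ 2)) := by
        gcongr
        nlinarith [sq_nonneg (x - 1)]
    _ ≤ Real.exp (rate N τ p r x - C * τ) := by
        rw [← Real.exp_add, ← Real.exp_add, ← Real.exp_add, Real.exp_le_exp]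
        linarith

lemma colorWeight_mul_le (hρ : IsNearRate N τ p r C ρ) (h : IsAdmissible τ p r) (hN : N ≠ 0)
    (k : ℕ) :
    colorWeight N (Real.exp (-τ)) k * ρ k ≤
      Real.exp (C * τ) * Real.exp (rate N τ p r 1 - N * slope τ p r) *
          colorWeight N (Real.exp (-tiltedStep τ p r)) k +
        Real.exp (N / 2) * colorWeight N (Real.exp (-(2 * τ))) k := by
  have hweight (a : ℝ) : 0 ≤ colorWeight N (Real.exp a) k :=
    colorWeight_nonneg N (Real.exp_pos a).le k
  have hN' : (0 : ℝ) < N := Nat.cast_pos.2 (Nat.pos_of_ne_zero hN)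
  rcases le_or_gt (1 / 2) ((k + 1) * τ / N) with hx | hx
  · refine le_add_of_le_of_nonneg ?_ (mul_nonneg (Real.exp_pos _).le (hweight _))
    rw [← colorWeight_mul_exp_slope hN, mul_left_comm]
    exact mul_le_mul_of_nonneg_left (hρ.le_exp_tangent h hx) (hweight _)
  · refine le_add_of_nonneg_of_le (mul_nonneg (by positivity) (hweight _)) ?_
    rw [show -(2 * τ) = -(τ - -τ) by ring, ← colorWeight_mul_exp, mul_left_comm, ← Real.exp_add]
    refine mul_le_mul_of_nonneg_left ((hρ.le_one k).trans (Real.one_le_exp ?_)) (hweight _)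
    rw [div_lt_iff₀ hN'] at hx
    linarith

lemma le_colorWeight_mul (hρ : IsNearRate N τ p r C ρ) (h : IsAdmissible τ p r) (hN : N ≠ 0)
    (k : ℕ) :
    Real.exp (-(C * τ)) * Real.exp (rate N τ p r 1 - N * slope τ p r) *
      (colorWeight N (Real.exp (-tiltedStep τ p r)) k - (2 * N * τ + 4) / (N / τ) ^ 2 *
        (colorWeight N (Real.exp (-tiltedStep τ p r)) k * (k + 1 - N / τ) ^ 2)) ≤
      colorWeight N (Real.exp (-τ)) k * ρ k := by
  have hτ := h.pos
  have hN' : (N : ℝ) ≠ 0 := Nat.cast_ne_zero.2 hN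
  have hweight (a : ℝ) : 0 ≤ colorWeight N (Real.exp a) k :=
    colorWeight_nonneg N (Real.exp_pos a).le k
  have hfactor (w : ℝ) : w - (2 * N * τ + 4) / (N / τ) ^ 2 * (w * (k + 1 - N / τ) ^ 2) =
      w * (1 - (2 * N * τ + 4) * ((k + 1) * τ / N - 1) ^ 2) := by
    field_simp
  rw [hfactor]
  rcases le_or_gt (1 / 2) ((k + 1) * τ / N) with hx | hx
  · rw [← colorWeight_mul_exp_slope hN]
    refine le_trans (le_of_eq ?_)
      (mul_le_mul_of_nonneg_left (hρ.exp_tangent_mul_le h hx) (hweight _))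
    ring
  · refine le_trans ?_ (mul_nonneg (hweight _) (hρ.nonneg k))
    have hfar : 1 / 4 ≤ ((k + 1) * τ / N - 1) ^ 2 := by nlinarith
    refine mul_nonpos_of_nonneg_of_nonpos (by positivity)
      (mul_nonpos_of_nonneg_of_nonpos (hweight _) ?_)
    have : 0 ≤ N * τ := by positivity
    nlinarith

lemma summable_colorWeight_mul (hρ : IsNearRate N τ p r C ρ) (hτ : 0 < τ) :
    Summable fun k => colorWeight N (Real.exp (-τ)) k * ρ k := by
  have hweight := colorWeight_nonneg N (Real.exp_pos (-τ)).le
  exact Summable.of_nonneg_of_le (fun k => mul_nonneg (hweight k) (hρ.nonneg k))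
    (fun k => mul_le_of_le_one_right (hweight k) (hρ.le_one k))
    (hasSum_colorWeight N (Real.exp_pos _).le (sub_pos.1 (one_sub_exp_neg_pos hτ))).summable

theorem tsum_colorWeight_mul_le (hρ : IsNearRate N τ p r C ρ) (h : IsAdmissible τ p r)
    (hN : N ≠ 0) :
    ∑' k, colorWeight N (Real.exp (-τ)) k * ρ k ≤
      Real.exp (C * τ) * tiltedMass N τ p r +
        Real.exp (N / 2) * (Real.exp (-(2 * τ)) / (1 - Real.exp (-(2 * τ))) ^ (N + 1)) := by
  have hmass {a : ℝ} (ha : 0 < a) :=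
    hasSum_colorWeight N (Real.exp_pos (-a)).le (sub_pos.1 (one_sub_exp_neg_pos ha))
  rw [tiltedMass, ← mul_assoc]
  exact hasSum_le (hρ.colorWeight_mul_le h hN) (hρ.summable_colorWeight_mul h.pos).hasSum
    (((hmass h.tiltedStep_pos).mul_left _).add ((hmass (by linarith [h.pos])).mul_left _))

theorem le_tsum_colorWeight_mul (hρ : IsNearRate N τ p r C ρ) (h : IsAdmissible τ p r)
    (hN : N ≠ 0) :
    Real.exp (-(C * τ)) * tiltedMass N τ p r *
        (1 - (2 * N * τ + 4) * (18 * τ ^ 2 + 12 / N)) ≤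
      ∑' k, colorWeight N (Real.exp (-τ)) k * ρ k := by
  have hτ := h.pos
  have ht1 := sub_pos.1 (one_sub_exp_neg_pos h.tiltedStep_pos)
  have hmoment := relative_second_moment_le (Nat.one_le_cast.2 (Nat.one_le_iff_ne_zero.2 hN)) hτ
    h.le_sixteenth h.mul_one_sub_le_tiltedStep h.tiltedStep_le
  have hsum := hasSum_le (hρ.le_colorWeight_mul h hN)
    (((hasSum_colorWeight N (Real.exp_pos _).le ht1).sub
      ((hasSum_colorWeight_mul_sq N (Real.exp_pos _).le ht1 (N / τ)).mul_left _)).mul_left _)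
    (hρ.summable_colorWeight_mul hτ).hasSum
  refine le_trans ?_ hsum
  rw [tiltedMass, ← mul_assoc, mul_assoc _ (_ / _) (1 - _)]
  refine mul_le_mul_of_nonneg_left ?_ (by positivity)
  have hfactor (y a b q : ℝ) : y - a / b * (y * q) = y * (1 - a * (q / b)) := by ring
  have := sub_pos.2 ht1
  rw [hfactor]
  gcongr

end IsNearRate
end tilt

/-! ### The main term -/

lemma one_div_exp_sub_one_le {x : ℝ} (h0 : 0 < x) (h1 : x ≤ 1) :
    1 / (Real.exp x - 1) ≤ 1 / x - 1 / 2 + x := by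
  have hquad := Real.quadratic_le_exp_of_nonneg h0.le
  have hnonneg : 0 ≤ 1 / x - 1 / 2 + x := by linarith [(one_le_div h0).2 h1]
  rw [div_le_iff₀ (by nlinarith)]
  calc 1 ≤ 1 + 3 / 4 * x ^ 2 + x ^ 3 / 2 := by linarith [pow_pos h0 2, pow_pos h0 3]
    _ = (1 / x - 1 / 2 + x) * (x + x ^ 2 / 2) := by field_simp; ring
    _ ≤ (1 / x - 1 / 2 + x) * (Real.exp x - 1) := by gcongr; linarith

lemma le_one_div_exp_sub_one {x : ℝ} (h0 : 0 < x) (h1 : x ≤ 1) :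
    1 / x - 1 / 2 - x ≤ 1 / (Real.exp x - 1) := by
  have hcubic : Real.exp x - 1 ≤ x + x ^ 2 / 2 + x ^ 3 / 4 := by
    have hbound := Real.exp_bound' h0.le h1 (n := 3) (by norm_num)
    norm_num [sum_range_succ, Nat.factorial] at hbound
    linarith [pow_pos h0 3]
  have hpos : 0 < Real.exp x - 1 := by linarith [Real.one_lt_exp_iff.2 h0]
  refine le_trans ?_ (one_div_le_one_div_of_le hpos hcubic)
  rw [le_div_iff₀ (by positivity)]
  calc (1 / x - 1 / 2 - x) * (x + x ^ 2 / 2 + x ^ 3 / 4)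
      = 1 - x ^ 2 - 5 / 8 * x ^ 3 - x ^ 4 / 4 := by field_simp; ring
    _ ≤ 1 := by linarith [pow_pos h0 2, pow_pos h0 3, pow_pos h0 4]

lemma hasDerivAt_log_one_sub_exp_neg {x : ℝ} (hx : 0 < x) :
    HasDerivAt (fun y => Real.log (1 - Real.exp (-y))) (1 / (Real.exp x - 1)) x := by
  have hderiv := ((hasDerivAt_neg x).exp.const_sub 1).log (one_sub_exp_neg_pos hx).ne'
  have hne : Real.exp x - 1 ≠ 0 := by linarith [Real.one_lt_exp_iff.2 hx]
  refine hderiv.congr_deriv ?_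
  rw [Real.exp_neg]
  have : 1 - (Real.exp x)⁻¹ = (Real.exp x - 1) / Real.exp x := by field_simp
  rw [this]
  field_simp

lemma abs_log_one_sub_exp_neg_sub_le {τ θ : ℝ} (hθ : 0 < θ) (hθτ : θ ≤ τ) (hτ : τ ≤ 1) :
    |Real.log (1 - Real.exp (-τ)) - Real.log (1 - Real.exp (-θ)) -
      (Real.log τ - Real.log θ - (τ - θ) / 2)| ≤ τ * (τ - θ) := by
  have hderiv (x : ℝ) (hx : x ∈ Set.Icc θ τ) : HasDerivWithinAt
      (fun y => Real.log (1 - Real.exp (-y)) - Real.log y + y / 2)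
      (1 / (Real.exp x - 1) - x⁻¹ + 1 / 2) (Set.Icc θ τ) x := by
    have hx0 : 0 < x := hθ.trans_le hx.1
    exact (((hasDerivAt_log_one_sub_exp_neg hx0).sub (Real.hasDerivAt_log hx0.ne')).add
      ((hasDerivAt_id x).div_const 2)).hasDerivWithinAt
  have hbound (x : ℝ) (hx : x ∈ Set.Icc θ τ) :
      ‖1 / (Real.exp x - 1) - x⁻¹ + 1 / 2‖ ≤ τ := by
    have hx0 : 0 < x := hθ.trans_le hx.1
    have hx1 : x ≤ 1 := hx.2.trans hτ
    rw [Real.norm_eq_abs, abs_le, ← one_div]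
    constructor <;> linarith [hx.2, one_div_exp_sub_one_le hx0 hx1, le_one_div_exp_sub_one hx0 hx1]
  have hmean := (convex_Icc θ τ).norm_image_sub_le_of_norm_hasDerivWithin_le hderiv hbound
    (Set.left_mem_Icc.2 hθτ) (Set.right_mem_Icc.2 hθτ)
  rw [Real.norm_eq_abs, Real.norm_eq_abs, abs_of_nonneg (sub_nonneg.2 hθτ)] at hmean
  convert hmean using 2
  ring

lemma abs_log_one_sub_exp_neg_taylor_le {τ β : ℝ} (hτ : 0 < τ) (hτ1 : τ ≤ 1 / 2) (hβ : 0 ≤ β)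
    (hβτ : β ≤ τ) :
    |Real.log (1 - Real.exp (-τ)) - Real.log (1 - Real.exp (-(τ * (1 - β)))) -
      (β + β ^ 2 / 2 - τ * β / 2)| ≤ 3 * τ ^ 3 := by
  have hdiff := abs_log_one_sub_exp_neg_sub_le (τ := τ) (θ := τ * (1 - β))
    (mul_pos hτ (by linarith)) (mul_le_of_le_one_right hτ.le (by linarith)) (by linarith)
  have hlog := abs_log_one_add_sub_le (x := -β) (by rw [abs_neg, abs_of_nonneg hβ]; linarith)
  rw [abs_neg, abs_of_nonneg hβ, ← sub_eq_add_neg] at hlog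
  rw [Real.log_mul hτ.ne' (by linarith), show τ - τ * (1 - β) = τ * β by ring] at hdiff
  have hcube : β ^ 3 ≤ τ ^ 3 := by gcongr
  have hcube' : τ * (τ * β) ≤ τ ^ 3 := by
    calc τ * (τ * β) ≤ τ * (τ * τ) := by gcongr
      _ = τ ^ 3 := by ring
  rw [abs_le] at hdiff hlog ⊢
  constructor <;> linarith [hdiff.1, hdiff.2, hlog.1, hlog.2]

/-- The logarithm of `tiltedMass N τ p r` after normalization by
`exp (τ / 2 + N * τ * p) * (1 - exp (-τ)) ^ (N + 1)`. -/
noncomputable def tiltedLog (N : ℕ) (τ p r : ℝ) : ℝ :=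
  τ / 2 + N * τ * p + (rate N τ p r 1 - N * slope τ p r) - tiltedStep τ p r +
    (N + 1) * (Real.log (1 - Real.exp (-τ)) - Real.log (1 - Real.exp (-tiltedStep τ p r)))

/-- Twice the limit of `tiltedLog N τ p r / (N * τ ^ 2)`; it becomes the variance of the normal
limit. -/
noncomputable def limitVariance (p r : ℝ) : ℝ := r + p ^ 2 - p

section mainTerm

variable {N : ℕ} {τ p r : ℝ}

lemma one_sub_exp_neg_pow_eq_exp {x : ℝ} (hx : 0 < x) (N : ℕ) :
    (1 - Real.exp (-x)) ^ (N + 1) = Real.exp ((N + 1) * Real.log (1 - Real.exp (-x))) := by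
  have hcast : (N + 1 : ℝ) = (N + 1 : ℕ) := by push_cast; rfl
  rw [hcast, Real.exp_nat_mul, Real.exp_log (one_sub_exp_neg_pos hx)]

lemma IsAdmissible.prefactor_mul_tiltedMass (h : IsAdmissible τ p r) (N : ℕ) :
    Real.exp (τ / 2 + N * τ * p) * (1 - Real.exp (-τ)) ^ (N + 1) * tiltedMass N τ p r =
      Real.exp (tiltedLog N τ p r) := by
  rw [tiltedMass, one_sub_exp_neg_pow_eq_exp h.pos, one_sub_exp_neg_pow_eq_exp h.tiltedStep_pos,
    ← Real.exp_sub, ← Real.exp_add, ← Real.exp_add, ← Real.exp_add, tiltedLog]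
  congr 1
  ring

lemma IsAdmissible.abs_quadratic_remainder_le (h : IsAdmissible τ p r) :
    |τ * r * (τ * r - 2 * p + 1) / 2| ≤ 2 * τ := by
  have hτ := h.pos
  have hr := h.quadratic_nonneg
  have hτr : τ * r ≤ τ :=
    mul_le_of_le_one_right hτ.le (h.quadratic_le_linear.trans h.linear_le_one)
  have hfactor : |τ * r - 2 * p + 1| ≤ 4 := by
    rw [abs_le]
    have : 0 ≤ τ * r := by positivity
    constructor <;> linarith [h.linear_nonneg, h.linear_le_one, h.le_sixteenth]
  rw [abs_div, abs_mul, abs_of_nonneg (by positivity : 0 ≤ τ * r), abs_two]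
  have := mul_le_mul hτr hfactor (abs_nonneg _) hτ.le
  linarith

lemma IsAdmissible.abs_boundary_remainder_le (h : IsAdmissible τ p r) :
    |τ / 2 - tiltedStep τ p r + slope τ p r + slope τ p r ^ 2 / 2 - τ * slope τ p r / 2| ≤
      3 * τ := by
  have hτ := h.pos
  have hβ := h.slope_nonneg
  have hβτ := h.slope_le
  have hsq : slope τ p r ^ 2 ≤ τ ^ 2 := by gcongr
  have hmul : τ * slope τ p r ≤ τ ^ 2 := by rw [sq]; gcongr
  have hmul0 : 0 ≤ τ * slope τ p r := by positivity
  rw [abs_le, tiltedStep, mul_one_sub]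
  constructor <;> linarith [sq_nonneg (slope τ p r), h.sq_le]

theorem IsAdmissible.abs_tiltedLog_sub_le (h : IsAdmissible τ p r) (N : ℕ) :
    |tiltedLog N τ p r - N * τ ^ 2 / 2 * limitVariance p r| ≤ (6 + 5 * (N * τ ^ 2)) * τ := by
  have hτ := h.pos
  have htaylor := abs_log_one_sub_exp_neg_taylor_le hτ (by linarith [h.le_sixteenth])
    h.slope_nonneg h.slope_le
  rw [← tiltedStep] at htaylor
  set E := Real.log (1 - Real.exp (-τ)) - Real.log (1 - Real.exp (-tiltedStep τ p r)) -
    (slope τ p r + slope τ p r ^ 2 / 2 - τ * slope τ p r / 2) with hE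
  have hsplit : tiltedLog N τ p r - N * τ ^ 2 / 2 * limitVariance p r =
      N * τ ^ 2 * (τ * r * (τ * r - 2 * p + 1) / 2) +
        (τ / 2 - tiltedStep τ p r + slope τ p r + slope τ p r ^ 2 / 2 - τ * slope τ p r / 2) +
        (N + 1) * E := by
    rw [hE, tiltedLog, limitVariance, rate, slope]
    ring
  have hcube : τ ^ 3 ≤ τ := by
    calc τ ^ 3 = τ ^ 2 * τ := by ring
      _ ≤ 1 * τ := by gcongr; linarith [h.sq_le, h.le_sixteenth]
      _ = τ := one_mul τ
  rw [hsplit]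
  calc _ ≤ |N * τ ^ 2 * (τ * r * (τ * r - 2 * p + 1) / 2)| +
        |τ / 2 - tiltedStep τ p r + slope τ p r + slope τ p r ^ 2 / 2 - τ * slope τ p r / 2| +
        |(N + 1) * E| := abs_add_three _ _ _
    _ ≤ N * τ ^ 2 * (2 * τ) + 3 * τ + (N + 1) * (3 * τ ^ 3) := by
        rw [abs_mul, abs_mul (N + 1 : ℝ), abs_of_nonneg (by positivity : 0 ≤ N * τ ^ 2),
          abs_of_nonneg (by positivity : (0 : ℝ) ≤ N + 1)]
        gcongr
        · exact h.abs_quadratic_remainder_le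
        · exact h.abs_boundary_remainder_le
    _ ≤ (6 + 5 * (N * τ ^ 2)) * τ := by linarith

lemma exp_nine_sixteenths_le : Real.exp (9 / 16) ≤ 19 / 20 * (31 / 16) := by
  have hsq : Real.exp (9 / 16) ^ 2 = Real.exp 1 * Real.exp (1 / 8) := by
    rw [← Real.exp_nat_mul, ← Real.exp_add]
    norm_num
  have heighth : Real.exp (1 / 8) ≤ 8 / 7 := by
    have := Real.add_one_le_exp (-(1 / 8 : ℝ))
    rw [Real.exp_neg, le_inv_comm₀ (by norm_num) (Real.exp_pos _)] at this
    exact this.trans (by norm_num)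
  refine (sq_le_sq₀ (Real.exp_pos _).le (by norm_num)).1 ?_
  calc Real.exp (9 / 16) ^ 2 ≤ 2.7182818286 * (8 / 7) := by
        rw [hsq]
        gcongr
        exact Real.exp_one_lt_d9.le
    _ ≤ (19 / 20 * (31 / 16)) ^ 2 := by norm_num

lemma pow_nineteen_twentieths_le (hN : N ≠ 0) : (19 / 20 : ℝ) ^ (N + 1) ≤ 20 / N := by
  have hN' : (0 : ℝ) < N := Nat.cast_pos.2 (Nat.pos_of_ne_zero hN)
  have hbernoulli := one_add_mul_le_pow (a := (1 / 19 : ℝ)) (by norm_num) (N + 1)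
  rw [show (19 / 20 : ℝ) = (1 + 1 / 19)⁻¹ by norm_num, inv_pow, inv_le_comm₀ (by positivity)
    (by positivity), inv_div]
  refine le_trans ?_ hbernoulli
  push_cast
  linarith

lemma tail_mass_le (hN : N ≠ 0) (hτ : 0 < τ) (hτ1 : τ ≤ 1 / 16) (hp : p ≤ 1) :
    Real.exp (τ / 2 + N * τ * p) * (1 - Real.exp (-τ)) ^ (N + 1) *
      (Real.exp (N / 2) * (Real.exp (-(2 * τ)) / (1 - Real.exp (-(2 * τ))) ^ (N + 1))) ≤
      20 / N := by
  have hv := one_sub_exp_neg_pos hτ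
  have hsq : Real.exp (-(2 * τ)) = Real.exp (-τ) ^ 2 := by
    rw [← Real.exp_nat_mul]
    congr 1
    push_cast
    ring
  have hprefactor : Real.exp (τ / 2 + N * τ * p) * Real.exp (N / 2) ≤
      Real.exp (9 / 16) ^ (N + 1) := by
    rw [← Real.exp_add, ← Real.exp_nat_mul, Real.exp_le_exp]
    have hlinear : N * τ * p ≤ N * (1 / 16) :=
      (mul_le_of_le_one_right (by positivity) hp).trans (by gcongr)
    push_cast
    linarith
  have hratio : Real.exp (9 / 16) / (1 + Real.exp (-τ)) ≤ 19 / 20 := by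
    rw [div_le_iff₀ (by positivity)]
    exact exp_nine_sixteenths_le.trans (by gcongr; linarith [Real.add_one_le_exp (-τ)])
  have ht := Real.exp_pos (-τ)
  rw [hsq]
  generalize Real.exp (-τ) = t at hv hratio ht ⊢
  calc _ = Real.exp (τ / 2 + N * τ * p) * Real.exp (N / 2) / (1 + t) ^ (N + 1) * t ^ 2 := by
        rw [show 1 - t ^ 2 = (1 - t) * (1 + t) by ring, mul_pow]
        field_simp
    _ ≤ Real.exp (9 / 16) ^ (N + 1) / (1 + t) ^ (N + 1) * 1 := by
        gcongr
        exact pow_le_one₀ ht.le (by linarith)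
    _ = (Real.exp (9 / 16) / (1 + t)) ^ (N + 1) := by rw [mul_one, div_pow]
    _ ≤ (19 / 20) ^ (N + 1) := by gcongr
    _ ≤ 20 / N := pow_nineteen_twentieths_le hN

/-- The normalized average of `ρ` under the weights `colorWeight N (exp (-τ))`; for
`ρ = compatibleRatio e c` this is the moment generating function of `descentMGF_eq_tsum`. -/
noncomputable def colorAverage (N : ℕ) (τ p : ℝ) (ρ : ℕ → ℝ) : ℝ :=
  Real.exp (τ / 2 + N * τ * p) *
    ((1 - Real.exp (-τ)) ^ (N + 1) * ∑' k, colorWeight N (Real.exp (-τ)) k * ρ k)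

namespace IsNearRate

variable {C : ℝ} {ρ : ℕ → ℝ}

lemma colorAverage_nonneg (hρ : IsNearRate N τ p r C ρ) (hτ : 0 < τ) :
    0 ≤ colorAverage N τ p ρ := by
  have hv := one_sub_exp_neg_pos hτ
  have hsum : 0 ≤ ∑' k, colorWeight N (Real.exp (-τ)) k * ρ k :=
    tsum_nonneg fun k => mul_nonneg (colorWeight_nonneg N (Real.exp_pos _).le k) (hρ.nonneg k)
  unfold colorAverage
  positivity

theorem colorAverage_le (hρ : IsNearRate N τ p r C ρ) (h : IsAdmissible τ p r) (hN : N ≠ 0) :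
    colorAverage N τ p ρ ≤ Real.exp ((C + 6 + 5 * (N * τ ^ 2)) * τ) *
      Real.exp (N * τ ^ 2 / 2 * limitVariance p r) + 20 / N := by
  have hv := one_sub_exp_neg_pos h.pos
  have hlog := (abs_le.1 (h.abs_tiltedLog_sub_le N)).2
  rw [colorAverage, ← mul_assoc]
  calc _ ≤ Real.exp (τ / 2 + N * τ * p) * (1 - Real.exp (-τ)) ^ (N + 1) *
        (Real.exp (C * τ) * tiltedMass N τ p r +
          Real.exp (N / 2) * (Real.exp (-(2 * τ)) / (1 - Real.exp (-(2 * τ))) ^ (N + 1))) := by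
        gcongr
        exact hρ.tsum_colorWeight_mul_le h hN
    _ ≤ Real.exp (C * τ) * Real.exp (tiltedLog N τ p r) + 20 / N := by
        rw [mul_add, mul_left_comm, h.prefactor_mul_tiltedMass]
        gcongr
        exact tail_mass_le hN h.pos h.le_sixteenth h.linear_le_one
    _ ≤ _ := by
        rw [← Real.exp_add, ← Real.exp_add]
        exact add_le_add (Real.exp_le_exp.2 (by linarith)) le_rfl

theorem le_colorAverage (hρ : IsNearRate N τ p r C ρ) (h : IsAdmissible τ p r) (hN : N ≠ 0)
    (hsmall : (2 * N * τ + 4) * (18 * τ ^ 2 + 12 / N) ≤ 1) :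
    Real.exp (-((C + 6 + 5 * (N * τ ^ 2)) * τ)) * Real.exp (N * τ ^ 2 / 2 * limitVariance p r) *
        (1 - (2 * N * τ + 4) * (18 * τ ^ 2 + 12 / N)) ≤ colorAverage N τ p ρ := by
  have hv := one_sub_exp_neg_pos h.pos
  have hlog := (abs_le.1 (h.abs_tiltedLog_sub_le N)).1
  rw [colorAverage, ← mul_assoc (Real.exp (τ / 2 + N * τ * p))]
  calc _ ≤ Real.exp (-(C * τ)) * Real.exp (tiltedLog N τ p r) *
        (1 - (2 * N * τ + 4) * (18 * τ ^ 2 + 12 / N)) := by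
        rw [← Real.exp_add, ← Real.exp_add]
        refine mul_le_mul_of_nonneg_right (Real.exp_le_exp.2 ?_) (sub_nonneg.2 hsmall)
        linarith
    _ = Real.exp (τ / 2 + N * τ * p) * (1 - Real.exp (-τ)) ^ (N + 1) *
        (Real.exp (-(C * τ)) * tiltedMass N τ p r *
          (1 - (2 * N * τ + 4) * (18 * τ ^ 2 + 12 / N))) := by
        rw [← h.prefactor_mul_tiltedMass]
        ring
    _ ≤ _ := by
        gcongr
        exact hρ.le_tsum_colorWeight_mul h hN

end IsNearRate
end mainTerm

/-! ### The rate of convergence -/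

lemma exp_mul_sub_one_le {a τ : ℝ} (ha : 0 ≤ a) (hτ : 0 ≤ τ) (hτ1 : τ ≤ 1) :
    Real.exp (a * τ) - 1 ≤ a * Real.exp a * τ := by
  have hmono : Real.exp (a * τ) ≤ Real.exp a := Real.exp_le_exp.2 (mul_le_of_le_one_right ha hτ1)
  have hneg := mul_le_mul_of_nonneg_left (Real.one_sub_le_exp_neg (a * τ)) (Real.exp_pos (a * τ)).le
  rw [← Real.exp_add, add_neg_cancel, Real.exp_zero] at hneg
  have := mul_le_mul_of_nonneg_left hmono (mul_nonneg ha hτ)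
  linarith

lemma abs_sub_le_of_exp_bounds {M G τ a b D K : ℝ} (hτ : 0 < τ) (hτ1 : τ ≤ 1) (ha : 0 ≤ a)
    (hb : 0 ≤ b) (hG : 0 ≤ G) (hM : 0 ≤ M) (hD0 : 0 ≤ D) (hD : D ≤ K * τ)
    (hlow : D ≤ 1 → Real.exp (-(a * τ)) * G * (1 - D) ≤ M)
    (hup : M ≤ Real.exp (a * τ) * G + b * τ) :
    |M - G| ≤ ((a * Real.exp a + a + K) * G + b) * τ := by
  have hK : 0 ≤ K := nonneg_of_mul_nonneg_left (hD0.trans hD) hτ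
  have hlow' : (1 - (a * τ + D)) * G ≤ M := by
    rcases le_or_gt D 1 with hD1 | hD1
    · refine le_trans ?_ (hlow hD1)
      rw [mul_right_comm]
      refine mul_le_mul_of_nonneg_right ?_ hG
      nlinarith [Real.one_sub_le_exp_neg (a * τ), mul_nonneg ha hτ.le]
    · refine le_trans (mul_nonpos_of_nonpos_of_nonneg ?_ hG) hM
      linarith [mul_nonneg ha hτ.le]
  have hexp := mul_le_mul_of_nonneg_right (exp_mul_sub_one_le ha hτ.le hτ1) hG
  have hDG := mul_le_mul_of_nonneg_right hD hG
  have haG : 0 ≤ a * Real.exp a * τ * G := by positivity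
  have hKG : 0 ≤ (a + K) * τ * G := by positivity
  have hbτ : 0 ≤ b * τ := by positivity
  rw [abs_le]
  constructor <;> linarith

lemma truncation_error_le {N τ : ℝ} (hN : 0 < N) (hτ : 0 < τ) (hτ1 : τ ≤ 1 / 16) :
    (2 * N * τ + 4) * (18 * τ ^ 2 + 12 / N) ≤
      (36 * (N * τ ^ 2) + 29 + 3 / (N * τ ^ 2)) * τ := by
  have hexpand : (2 * N * τ + 4) * (18 * τ ^ 2 + 12 / N) =
      36 * (N * τ ^ 2) * τ + 24 * τ + 72 * τ * τ + 48 * τ * τ / (N * τ ^ 2) := by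
    field_simp
    ring
  have hsq : 48 * τ * τ / (N * τ ^ 2) ≤ 3 * τ / (N * τ ^ 2) :=
    div_le_div_of_nonneg_right (by nlinarith) (by positivity)
  have hdiv : 3 * τ / (N * τ ^ 2) = 3 / (N * τ ^ 2) * τ := by ring
  rw [hexpand]
  nlinarith

theorem IsNearRate.abs_exp_mul_colorAverage_sub_le {N : ℕ} {τ p r C δ S : ℝ} {ρ : ℕ → ℝ}
    (hρ : IsNearRate N τ p r C ρ) (h : IsAdmissible τ p r) (hN : N ≠ 0) (hC : 0 ≤ C)
    (hδ : |δ| ≤ τ) (hS : N * τ ^ 2 = S) :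
    |Real.exp δ * colorAverage N τ p ρ - Real.exp (S / 2 * limitVariance p r)| ≤
      (((C + 7 + 5 * S) * Real.exp (C + 7 + 5 * S) + (C + 7 + 5 * S) + (36 * S + 29 + 3 / S)) *
        Real.exp (S / 2 * limitVariance p r) + 60 / S) * τ := by
  subst hS
  have hτ := h.pos
  have hτ1 := h.le_sixteenth
  have hN' : (0 : ℝ) < N := Nat.cast_pos.2 (Nat.pos_of_ne_zero hN)
  obtain ⟨hδlow, hδup⟩ := abs_le.1 hδ
  have hδ3 : Real.exp δ ≤ 3 :=
    (Real.exp_le_exp.2 (by linarith : δ ≤ 1)).trans (by linarith [Real.exp_one_lt_d9])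
  refine abs_sub_le_of_exp_bounds hτ (by linarith) (by positivity) (by positivity)
    (Real.exp_pos _).le (mul_nonneg (Real.exp_pos _).le (hρ.colorAverage_nonneg hτ))
    (by positivity) (truncation_error_le hN' hτ hτ1) (fun hsmall => ?_) ?_
  · refine le_trans ?_
      (mul_le_mul_of_nonneg_left (hρ.le_colorAverage h hN hsmall) (Real.exp_pos δ).le)
    rw [← mul_assoc, ← mul_assoc, ← Real.exp_add, ← Real.exp_add, ← Real.exp_add]
    refine mul_le_mul_of_nonneg_right (Real.exp_le_exp.2 ?_) (sub_nonneg.2 hsmall)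
    linarith
  · refine (mul_le_mul_of_nonneg_left (hρ.colorAverage_le h hN) (Real.exp_pos δ).le).trans ?_
    rw [mul_add]
    refine add_le_add ?_ ?_
    · rw [← mul_assoc, ← Real.exp_add, ← Real.exp_add, ← Real.exp_add, Real.exp_le_exp]
      linarith
    · calc Real.exp δ * (20 / N) ≤ 3 * (20 / N) := by gcongr
        _ = 60 / (N * τ ^ 2) * (τ * τ) := by field_simp; norm_num
        _ ≤ 60 / (N * τ ^ 2) * τ := by
            gcongr
            exact mul_le_of_le_one_left hτ.le (by linarith)

section coefficients

variable {τ α : ℝ}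

lemma isAdmissible_linearCoeff_quadraticCoeff (e : Bool) (hτ : 0 < τ) (hτ1 : τ ≤ 1 / 16)
    (h0 : 0 ≤ α) (h1 : α ≤ 1) : IsAdmissible τ (linearCoeff e α) (quadraticCoeff α) where
  pos := hτ
  le_sixteenth := hτ1
  quadratic_nonneg := by
    unfold quadraticCoeff
    linarith [pow_le_one₀ (n := 3) h0 h1]
  quadratic_le_linear := by
    have hα3 : 0 ≤ α ^ 3 := by positivity
    have hkey : 0 ≤ (1 - α) ^ 2 * (1 + 2 * α) := by positivity
    cases e <;> norm_num [linearCoeff, quadraticCoeff, orientSign] <;> nlinarith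
  linear_le_one := by
    have hα2 := pow_le_one₀ (n := 2) h0 h1
    cases e <;> norm_num [linearCoeff, orientSign] <;> nlinarith

lemma limitVariance_linearCoeff_quadraticCoeff (e : Bool) (α : ℝ) :
    limitVariance (linearCoeff e α) (quadraticCoeff α) = (1 - 4 * α ^ 3 + 3 * α ^ 4) / 12 := by
  unfold limitVariance linearCoeff quadraticCoeff
  linear_combination α ^ 4 / 4 * orientSign_sq e

/-- The moment generating function of the limiting normal law, as a function of `S = s ^ 2`. -/
noncomputable def limitMGF (S α : ℝ) : ℝ := Real.exp (S / 24 * (1 - 4 * α ^ 3 + 3 * α ^ 4))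

lemma limitMGF_pos (S α : ℝ) : 0 < limitMGF S α := Real.exp_pos _

lemma limitMGF_le {S : ℝ} (hS : 0 ≤ S) (h0 : 0 ≤ α) (h1 : α ≤ 1) :
    limitMGF S α ≤ Real.exp S := by
  have hcube : 0 ≤ α ^ 3 := by positivity
  have hquartic : 3 * α ^ 4 ≤ 4 * α ^ 3 := by nlinarith
  refine Real.exp_le_exp.2 ?_
  nlinarith

end coefficients

/-- The constant in `abs_descentMGF_sub_limitMGF_le`. -/
noncomputable def errorConstant (S : ℝ) : ℝ :=
  ((16 + 37 * S) * Real.exp (16 + 37 * S) + (16 + 37 * S) + (36 * S + 29 + 3 / S)) * Real.exp S +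
    60 / S

section convergence

variable {n : ℕ}

lemma mult_one_le (lam : n.Partition) : mult lam 1 ≤ n := by
  obtain ⟨c, hc⟩ := conjClass_nonempty lam
  rw [mult_one_eq_card_fixedSet hc]
  exact card_finset_fin_le _

lemma fixedRatio_nonneg (lam : n.Partition) : 0 ≤ fixedRatio lam := by
  unfold fixedRatio; positivity

lemma fixedRatio_le_one (lam : n.Partition) : fixedRatio lam ≤ 1 :=
  div_le_one_of_le₀ (Nat.cast_le.2 (mult_one_le lam)) (Nat.cast_nonneg n)

lemma isNearRate_compatibleRatio {lam : (n + 1).Partition} {c : Equiv.Perm (Fin (n + 1))}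
    (hc : c ∈ conjClass lam) (e : Bool) {τ : ℝ} (hτ : 0 < τ) (hτ1 : τ ≤ 1 / 16) :
    IsNearRate (n + 1) τ (linearCoeff e (fixedRatio lam)) (quadraticCoeff (fixedRatio lam))
      (9 + 32 * ((n + 1 : ℕ) * τ ^ 2)) (fun k => compatibleRatio e c (k + 1)) := by
  have hbounds (k : ℕ) (hx : 1 / 2 ≤ (k + 1) * τ / (n + 1 : ℕ)) :=
    compatibleRatio_bounds (k := k + 1) e c (N := (n + 1 : ℕ)) (α := fixedRatio lam) (by simp)
      (by rw [fixedRatio, mult_one_eq_card_fixedSet hc]) hτ hτ1 (by rwa [Nat.cast_succ k])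
  exact {
    nonneg := fun k => compatibleRatio_nonneg e c _
    le_one := fun k => compatibleRatio_le_one e c _
    lower := fun {k} hx => by simpa only [Nat.cast_succ k] using (hbounds k hx).1
    upper := fun {k} hx => by simpa only [Nat.cast_succ k] using (hbounds k hx).2 }

theorem abs_descentMGF_sub_limitMGF_le (lam : (n + 1).Partition) (e : Bool) {τ S : ℝ} (hτ : 0 < τ)
    (hτ1 : τ ≤ 1 / 16) (hS : (n + 1 : ℕ) * τ ^ 2 = S) :
    |descentMGF lam (-(orientSign e * (τ * √(n + 1 : ℕ)))) - limitMGF S (fixedRatio lam)| ≤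
      errorConstant S * τ := by
  obtain ⟨c, hc⟩ := conjClass_nonempty lam
  have hS0 : 0 < S := hS ▸ (by positivity)
  have hα0 := fixedRatio_nonneg lam
  have hα1 := fixedRatio_le_one lam
  have hlimit : limitMGF S (fixedRatio lam) = Real.exp (S / 2 *
      limitVariance (linearCoeff e (fixedRatio lam)) (quadraticCoeff (fixedRatio lam))) := by
    rw [limitMGF, limitVariance_linearCoeff_quadraticCoeff]
    congr 1
    ring
  have hestimate := (isNearRate_compatibleRatio hc e hτ hτ1).abs_exp_mul_colorAverage_sub_le
    (isAdmissible_linearCoeff_quadraticCoeff e hτ hτ1 hα0 hα1) n.succ_ne_zero (by positivity)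
    (δ := orientSign e * τ) (by rw [abs_mul, abs_orientSign, one_mul, abs_of_pos hτ]) hS
  rw [descentMGF_eq_tsum hc e hτ]
  rw [← hlimit, hS, show 9 + 32 * S + 7 + 5 * S = 16 + 37 * S by ring] at hestimate
  refine hestimate.trans (mul_le_mul_of_nonneg_right ?_ hτ.le)
  unfold errorConstant
  gcongr
  exact limitMGF_le hS0.le hα0 hα1

lemma abs_normalizedDescent_le (lam : (n + 1).Partition) (π : Equiv.Perm (Fin (n + 1))) :
    |normalizedDescent lam π| ≤ 2 * √(n + 1 : ℕ) := by
  have hN1 : (1 : ℝ) ≤ (n + 1 : ℕ) := by exact_mod_cast Nat.succ_pos n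
  have hdescent : (descentNumber π : ℝ) ≤ (n + 1 : ℕ) := by
    exact_mod_cast (descentNumber_le π).trans n.le_succ
  have hmult : (mult lam 1 : ℝ) ^ 2 / (2 * (n + 1 : ℕ)) ≤ (n + 1 : ℕ) / 2 := by
    have : (mult lam 1 : ℝ) ≤ (n + 1 : ℕ) := Nat.cast_le.2 (mult_one_le lam)
    rw [div_le_iff₀ (by positivity)]
    nlinarith
  have hmult0 : 0 ≤ (mult lam 1 : ℝ) ^ 2 / (2 * (n + 1 : ℕ)) := by positivity
  have hsqrt : 0 < √((n + 1 : ℕ) : ℝ) := Real.sqrt_pos.2 (by positivity)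
  rw [normalizedDescent, abs_div, abs_of_pos hsqrt, div_le_iff₀ hsqrt, mul_assoc,
    Real.mul_self_sqrt (by positivity), abs_le]
  constructor <;> linarith [(descentNumber π).cast_nonneg (α := ℝ)]

lemma descentMGF_nonneg (lam : n.Partition) (s : ℝ) : 0 ≤ descentMGF lam s :=
  ProbabilityTheory.mgf_nonneg

lemma descentMGF_le (lam : (n + 1).Partition) (s : ℝ) :
    descentMGF lam s ≤ Real.exp (|s| * (2 * √(n + 1 : ℕ))) := by
  have hcard : (0 : ℝ) < #(conjClass lam) := by
    exact_mod_cast card_pos.2 (conjClass_nonempty lam)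
  rw [descentMGF_eq_sum, div_le_iff₀ hcard, mul_comm, ← nsmul_eq_mul]
  refine sum_le_card_nsmul _ _ _ fun π _ => Real.exp_le_exp.2 ?_
  calc s * normalizedDescent lam π ≤ |s| * |normalizedDescent lam π| := by
        rw [← abs_mul]
        exact le_abs_self _
    _ ≤ |s| * (2 * √(n + 1 : ℕ)) := by gcongr; exact abs_normalizedDescent_le lam π

lemma descentMGF_zero (lam : n.Partition) : descentMGF lam 0 = 1 := by
  have hcard : (#(conjClass lam) : ℝ) ≠ 0 := by
    exact_mod_cast (card_pos.2 (conjClass_nonempty lam)).ne'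
  simp [descentMGF_eq_sum, hcard]

lemma abs_descentMGF_sub_limitMGF_le_of_large (lam : (n + 1).Partition) {s : ℝ} (hs : s ≠ 0)
    (hlarge : 16 * |s| ≤ √(n + 1 : ℕ)) :
    |descentMGF lam s - limitMGF (s ^ 2) (fixedRatio lam)| ≤
      errorConstant (s ^ 2) * |s| / √(n + 1 : ℕ) := by
  have hsqrt : 0 < √((n + 1 : ℕ) : ℝ) := Real.sqrt_pos.2 (by positivity)
  have hτ1 : |s| / √(n + 1 : ℕ) ≤ 1 / 16 := by
    rw [div_le_iff₀ hsqrt]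
    linarith
  have hS : (n + 1 : ℕ) * (|s| / √(n + 1 : ℕ)) ^ 2 = s ^ 2 := by
    rw [div_pow, Real.sq_sqrt (by positivity), sq_abs]
    field_simp
  have hsign : -(orientSign (decide (s < 0)) * |s|) = s := by
    rcases lt_or_ge s 0 with hneg | hnonneg
    · simp [orientSign, hneg, abs_of_neg hneg]
    · simp [orientSign, not_lt.2 hnonneg, abs_of_nonneg hnonneg]
  have hestimate := abs_descentMGF_sub_limitMGF_le lam (decide (s < 0)) (by positivity) hτ1 hS
  rwa [div_mul_cancel₀ _ hsqrt.ne', hsign, ← mul_div_assoc] at hestimate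

lemma abs_descentMGF_sub_limitMGF_le_of_small (lam : (n + 1).Partition) {s : ℝ}
    (hsmall : √(n + 1 : ℕ) ≤ 16 * |s|) :
    |descentMGF lam s - limitMGF (s ^ 2) (fixedRatio lam)| ≤
      (Real.exp (|s| * (2 * (16 * |s|))) + Real.exp (s ^ 2)) * (16 * |s|) / √(n + 1 : ℕ) := by
  have hsqrt : 0 < √((n + 1 : ℕ) : ℝ) := Real.sqrt_pos.2 (by positivity)
  have hmgf : descentMGF lam s ≤ Real.exp (|s| * (2 * (16 * |s|))) :=
    (descentMGF_le lam s).trans (by gcongr)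
  have hlimit := limitMGF_le (sq_nonneg s) (fixedRatio_nonneg lam) (fixedRatio_le_one lam)
  rw [mul_div_assoc]
  refine le_trans ?_ (le_mul_of_one_le_right (by positivity) ((one_le_div hsqrt).2 hsmall))
  rw [abs_le]
  constructor <;> linarith [descentMGF_nonneg lam s, limitMGF_pos (s ^ 2) (fixedRatio lam),
    Real.exp_pos (s ^ 2), Real.exp_pos (|s| * (2 * (16 * |s|)))]

end convergence

end ConjDescents

open ConjDescents in
theorem theorem1p4_general :
    ∃ C : ℝ → ℝ, (∀ s : ℝ, 0 < C s) ∧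
      ∀ (n : ℕ), 0 < n → ∀ (lam : n.Partition) (s : ℝ),
        |descentMGF lam s -
            Real.exp (s ^ 2 / 24 * (1 - 4 * fixedRatio lam ^ 3 + 3 * fixedRatio lam ^ 4))| ≤
          C s / √n := by
  refine ⟨fun s => errorConstant (s ^ 2) * |s| +
    (Real.exp (|s| * (2 * (16 * |s|))) + Real.exp (s ^ 2)) * (16 * |s|) + 1, fun s => ?_,
    fun n hn lam s => ?_⟩
  · unfold errorConstant
    positivity
  obtain ⟨n, rfl⟩ := Nat.exists_eq_add_one.2 hn
  change |descentMGF lam s - limitMGF (s ^ 2) (fixedRatio lam)| ≤ _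
  have hlargeConst : 0 ≤ errorConstant (s ^ 2) * |s| := by unfold errorConstant; positivity
  have hsmallConst : 0 ≤ (Real.exp (|s| * (2 * (16 * |s|))) + Real.exp (s ^ 2)) * (16 * |s|) := by
    positivity
  rcases eq_or_ne s 0 with rfl | hs
  · simp [descentMGF_zero, limitMGF]
  rcases le_total (16 * |s|) √(n + 1 : ℕ) with hlarge | hsmall
  · refine (abs_descentMGF_sub_limitMGF_le_of_large lam hs hlarge).trans ?_
    gcongr
    linarith
  · refine (abs_descentMGF_sub_limitMGF_le_of_small lam hsmall).trans ?_
    gcongr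
    linarith

theorem theorem1p4 :
    ∃ C : ℝ → ℝ, (∀ s : ℝ, 0 < C s) ∧
      ∀ (n : ℕ), 2 ≤ n → ∀ (lam : n.Partition) (s : ℝ),
        |ConjDescents.descentMGF lam s -
            Real.exp (s ^ 2 / 24 *
              (1 - 4 * ConjDescents.fixedRatio lam ^ 3 + 3 * ConjDescents.fixedRatio lam ^ 4))|
          ≤ C s * (Real.log (n : ℝ) ^ 3 / Real.sqrt (n : ℝ)) := by
  obtain ⟨C, hCpos, hC⟩ := theorem1p4_general
  have hlog2 : 0 < Real.log 2 ^ 3 := pow_pos (Real.log_pos one_lt_two) 3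
  refine ⟨fun s => C s / Real.log 2 ^ 3, fun s => div_pos (hCpos s) hlog2,
    fun n hn lam s => (hC n (by omega) lam s).trans ?_⟩
  have hlog : Real.log 2 ^ 3 ≤ Real.log n ^ 3 := by
    gcongr
    exact_mod_cast hn
  rw [← mul_div_assoc, div_mul_eq_mul_div, mul_div_assoc (C s)]
  gcongr
  exact le_mul_of_one_le_right (hCpos s).le ((one_le_div hlog2).2 hlog)
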